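/- **Conventions.** A ranked set is a set $C$ with a function $rank\colon C\to\mathbb N$. A hypergraph over $C$ is a tuple $G=\langle V_G,E_G,att_G,lab_G,ext_G\rangle$ with finite sets $V_G$ of nodes and $E_G$ of hyperedges, where $att_G$ assigns to each hyperedge a sequence of pairwise distinct nodes, $lab_G\colon E_G\to C$ satisfies $rank(lab_G(e))=|att_G(e)|$, and $ext_G$ is a sequence of pairwise distinct (external) nodes; $rank(G)=|ext_G|$ and $rank(e)=|att_G(e)|$. Isomorphic hypergraphs are not distinguished. The handle $a^\bullet$ has $rank(a)$ nodes, all external, and one edge, labelled $a$ and attached to the sequence of external nodes. If $rank(e)=rank(K)$, then $G[e/K]$ is obtained by removing $e$, adding a disjoint copy of $K$ and fusing the $i$-th external node of $K$ with the $i$-th attachment node of $e$ for all $i$; simultaneous replacement $G[e_1/K_1,\dots,e_l/K_l]$ is defined likewise. **The hypergraph Lambek calculus $\mathrm{HL}$.** Types and their ranks are defined inductively: there are countably infinitely many primitive types of each rank; if $N$ is a type and $D$ is a hypergraph with $rank(D)=rank(N)$, exactly one edge $d_0$ of which is labelled by the symbol $\$$ while the other edges are labelled by types, then $N\div D$ is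 a type of rank $rank(d_0)$; if $M$ is a hypergraph labelled by types, then $\times(M)$ is a type of rank $rank(M)$. A sequent $H\to A$ consists of a hypergraph $H$ labelled by types and a type $A$ with $rank(H)=rank(A)$. The derivable sequents form the least set such that * $p^\bullet\to p$ is derivable for each primitive type $p$; * $(\div\to)$: if $e\in E_H$ is labelled by $N$, $N\div D$ is a type, the edges of $D$ are $d_0$ (labelled by $\$$) and $d_1,\dots,d_k$ (labelled by $T_1,\dots,T_k$), and $H\to A$, $H_1\to T_1$, …, $H_k\to T_k$ are derivable, then so is $H[e/D']\to A$, where $D'=D[d_0/(N\div D)^\bullet,d_1/H_1,\dots,d_k/H_k]$; * $(\to\div)$: if $D[d_0/F]\to N$ is derivable, where $d_0$ is the $\$$-edge of $D$, then so is $F\to N\div D$; * $(\times\to)$: if $e\in E_G$ is labelled by $\times(F)$ and $G[e/F]\to A$ is derivable, then so is $G\to A$; * $(\to\times)$: if $E_M=\{m_1,\dots,m_l\}$ and $H_i\to lab_M(m_i)$ is derivable for $i=1,\dots,l$, then so is $M[m_1/H_1,\dots,m_l/H_l]\to\times(M)$. An HL-grammar $\langle\Sigma,S,\triangleright\rangle$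 consists of a finite ranked alphabet $\Sigma$, a type $S$, and a finite relation $\triangleright$ between $\Sigma$ and the set of types such that $a\triangleright T$ implies $rank(a)=rank(T)$. Its language is the set of all hypergraphs $G$ over $\Sigma$ whose edges $e$ can be relabelled by types $f(e)$ with $lab_G(e)\triangleright f(e)$ in such a way that the relabelled hypergraph $f(G)$ gives a derivable sequent $f(G)\to S$. **Theorem.** Let $\ast$ be a symbol of rank $2$, and let $\mathcal L_3$ be the set of all hypergraphs over $\{\ast\}$ (finite directed multigraphs without loops; parallel edges are allowed) that have no external nodes, have at least one node, and are regular, that is, for some integer $k\ge 1$ the indegree and the outdegree of every node equal $k$. Then there is an HL-grammar over the alphabet $\{\ast\}$ whose language is exactly $\mathcal L_3$. -/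

import Mathlib

namespace HL

universe u v

/-- The unlabelled part of a finite hypergraph of rank `r`: finite sets `V` of nodes and `E` of
hyperedges; the hyperedge `e` is attached to a sequence of `rk e` distinct nodes; and there is a
sequence of `r` distinct external nodes. -/
structure Skel (r : ℕ) where
  V : Type
  E : Type
  finV : Finite V
  finE : Finite E
  rk : E → ℕ
  att : ∀ e : E, Fin (rk e) ↪ V
  ext : Fin r ↪ V

/-- A ranked set is given as a family `C : ℕ → Type*`, where `C n` consists of the elements of
rank `n`. A hypergraph of rank `r` over `C`: the label of a hyperedge has the rank of that
hyperedge. -/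
structure Graph (C : ℕ → Type u) (r : ℕ) extends Skel r where
  lab : ∀ e : E, C (rk e)

/-- The unlabelled part of a hypergraph of rank `r` with exactly one edge labelled by the special
symbol "dollar", that edge being of rank `k`. The dollar edge is kept apart: `hole` is its
attachment sequence, and `E` is the set of all the other edges. -/
structure DSkel (r k : ℕ) extends Skel r where
  hole : Fin k ↪ V

/-- The types of the hypergraph Lambek calculus; `Tp n` is the set of types of rank `n`.
For every rank there are countably many primitive types `prim r i`;
`div N D lab` is `N ÷ D`, where `D` is a hypergraph with one dollar edge whose other edges are
labelled by the types `lab`; `prod M lab` is `×(M)`, where the edges of `M` are labelled by the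
types `lab`. -/
inductive Tp : ℕ → Type 1
  | prim (r : ℕ) (i : ℕ) : Tp r
  | div {r k : ℕ} (N : Tp r) (D : DSkel r k) (lab : ∀ d : D.E, Tp (D.rk d)) : Tp k
  | prod {r : ℕ} (M : Skel r) (lab : ∀ m : M.E, Tp (M.rk m)) : Tp r

/-- The type `×(M)` of a hypergraph `M` labelled by types. -/
def Tp.times {r : ℕ} (M : Graph Tp r) : Tp r := Tp.prod M.toSkel M.lab

/-- The handle of a label `a` of rank `n`: nodes `v₁, …, vₙ`, all of them external, in this order,
and one edge, labelled by `a` and attached to `v₁ … vₙ`. -/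
def handle {C : ℕ → Type u} {n : ℕ} (a : C n) : Graph C n where
  V := Fin n
  E := Unit
  finV := inferInstance
  finE := inferInstance
  rk := fun _ => n
  att := fun _ => Function.Embedding.refl _
  ext := Function.Embedding.refl _
  lab := fun _ => a

/-- The nodes of `K` that are not external. -/
abbrev Skel.Inner {r : ℕ} (K : Skel r) : Type := {v : K.V // v ∉ Set.range K.ext}

/-- Nodes of the result of replacing every edge `e` of `M` by `K e`: the nodes of `M` and the
non-external nodes of all `K e`. -/
abbrev SubstNode {r : ℕ} (M : Skel r) (K : ∀ e : M.E, Skel (M.rk e)) : Type :=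
  M.V ⊕ (Σ e : M.E, (K e).Inner)

open Classical in
/-- Where a node of `K e` goes when all edges of `M` are replaced: the `i`-th external node of
`K e` is fused with the `i`-th attachment node of `e`, the other nodes are kept. -/
noncomputable def glueFun {r : ℕ} (M : Skel r) (K : ∀ e : M.E, Skel (M.rk e)) (e : M.E)
    (v : (K e).V) : SubstNode M K :=
  if h : v ∈ Set.range (K e).ext then Sum.inl (M.att e h.choose)
  else Sum.inr ⟨e, ⟨v, h⟩⟩

theorem glueFun_injective {r : ℕ} (M : Skel r) (K : ∀ e : M.E, Skel (M.rk e)) (e : M.E) :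
    Function.Injective (glueFun M K e) := by
  intro v w h
  unfold glueFun at h
  split_ifs at h with hv hw hw
  · have h1 := (M.att e).injective (Sum.inl.inj h)
    rw [← hv.choose_spec, ← hw.choose_spec, h1]
  · have h1 := Sum.inr.inj h
    simpa using h1

/-- `glueFun` as an embedding. -/
noncomputable def glue {r : ℕ} (M : Skel r) (K : ∀ e : M.E, Skel (M.rk e)) (e : M.E) :
    (K e).V ↪ SubstNode M K :=
  ⟨glueFun M K e, glueFun_injective M K e⟩

/-- Simultaneous replacement `M[m₁/K₁, …, mₗ/Kₗ]` of all the edges `m₁, …, mₗ` of `M`. -/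
noncomputable def Skel.subst {C : ℕ → Type u} {r : ℕ} (M : Skel r)
    (K : ∀ e : M.E, Graph C (M.rk e)) : Graph C r where
  V := SubstNode M (fun e => (K e).toSkel)
  E := Σ e : M.E, (K e).E
  finV := by
    have := M.finV
    have := M.finE
    have : ∀ e, Finite (K e).V := fun e => (K e).finV
    infer_instance
  finE := by
    have := M.finE
    have : ∀ e, Finite (K e).E := fun e => (K e).finE
    infer_instance
  rk := fun p => (K p.1).rk p.2
  att := fun p => ((K p.1).att p.2).trans (glue M (fun e => (K e).toSkel) p.1)
  ext := M.ext.trans Function.Embedding.inl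
  lab := fun p => (K p.1).lab p.2

open Classical in
/-- The replacement `G[e₀/K]` of one edge. The other edges are replaced by handles of their own
labels, which, up to isomorphism, leaves them as they are. -/
noncomputable def Graph.replace {C : ℕ → Type u} {r : ℕ} (G : Graph C r) (e₀ : G.E)
    (K : Graph C (G.rk e₀)) : Graph C r :=
  G.toSkel.subst (Function.update (fun e => handle (G.lab e)) e₀ K)

/-- The hypergraph skeleton in which the dollar edge of `D` is an ordinary edge, named `none`. -/
def DSkel.full {r k : ℕ} (D : DSkel r k) : Skel r where
  V := D.V
  E := Option D.E
  finV := D.finV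
  finE := by
    have := D.finE
    infer_instance
  rk := fun o => match o with
    | none => k
    | some d => D.rk d
  att := fun o => match o with
    | none => D.hole
    | some d => D.att d
  ext := D.ext

/-- `D[d₀/F, d₁/K₁, …, dₖ/Kₖ]`, where `d₀` is the dollar edge of `D` and `d₁, …, dₖ` are the other
edges. -/
noncomputable def DSkel.fill {C : ℕ → Type u} {r k : ℕ} (D : DSkel r k) (F : Graph C k)
    (K : ∀ d : D.E, Graph C (D.rk d)) : Graph C r :=
  D.full.subst (fun o => match o with
    | none => F
    | some d => K d)

/-- Isomorphisms of unlabelled hypergraphs. -/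
structure Skel.Iso {r : ℕ} (G H : Skel r) where
  onV : G.V ≃ H.V
  onE : G.E ≃ H.E
  rk_eq : ∀ e, G.rk e = H.rk (onE e)
  att_eq : ∀ e (i : Fin (G.rk e)), H.att (onE e) (Fin.cast (rk_eq e) i) = onV (G.att e i)
  ext_eq : ∀ i, H.ext i = onV (G.ext i)

/-- Isomorphic hypergraphs are not distinguished. Accordingly, two types are the same if they are
built in the same way from isomorphic hypergraphs (hereditarily). Types of different ranks are
never the same. -/
inductive Tp.Same : ∀ {m n : ℕ}, Tp m → Tp n → Prop
  | prim (r i : ℕ) : Tp.Same (Tp.prim r i) (Tp.prim r i)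
  | div {r k : ℕ} {N N' : Tp r} {D D' : DSkel r k}
      {lab : ∀ d : D.E, Tp (D.rk d)} {lab' : ∀ d : D'.E, Tp (D'.rk d)}
      (φ : D.toSkel.Iso D'.toSkel) (hole_eq : ∀ i, D'.hole i = φ.onV (D.hole i))
      (hN : Tp.Same N N') (hlab : ∀ d, Tp.Same (lab d) (lab' (φ.onE d))) :
      Tp.Same (Tp.div N D lab) (Tp.div N' D' lab')
  | prod {r : ℕ} {M M' : Skel r}
      {lab : ∀ m : M.E, Tp (M.rk m)} {lab' : ∀ m : M'.E, Tp (M'.rk m)}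
      (φ : M.Iso M') (hlab : ∀ m, Tp.Same (lab m) (lab' (φ.onE m))) :
      Tp.Same (Tp.prod M lab) (Tp.prod M' lab')

/-- Isomorphism of hypergraphs labelled by types. -/
def Graph.Same {r : ℕ} (G H : Graph Tp r) : Prop :=
  ∃ φ : G.toSkel.Iso H.toSkel, ∀ e, Tp.Same (G.lab e) (H.lab (φ.onE e))

/-- `Derivable H A`: the sequent `H → A` is derivable in the hypergraph Lambek calculus. (The
antecedent and the succedent of a sequent have the same rank.) The last clause says that
derivability is a property of sequents in which isomorphic hypergraphs are not distinguished. -/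
inductive Derivable : ∀ {r : ℕ}, Graph Tp r → Tp r → Prop
  | ax (r i : ℕ) : Derivable (handle (Tp.prim r i)) (Tp.prim r i)
  | div_left {r k : ℕ} (H : Graph Tp r) (A : Tp r) (e : H.E) (D : DSkel (H.rk e) k)
      (lab : ∀ d : D.E, Tp (D.rk d)) (K : ∀ d : D.E, Graph Tp (D.rk d))
      (hH : Derivable H A) (hK : ∀ d, Derivable (K d) (lab d)) :
      Derivable (H.replace e (D.fill (handle (Tp.div (H.lab e) D lab)) K)) A
  | div_right {r k : ℕ} (F : Graph Tp k) (N : Tp r) (D : DSkel r k)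
      (lab : ∀ d : D.E, Tp (D.rk d))
      (h : Derivable (D.fill F (fun d => handle (lab d))) N) :
      Derivable F (Tp.div N D lab)
  | times_left {r : ℕ} (G : Graph Tp r) (A : Tp r) (e : G.E) (F : Graph Tp (G.rk e))
      (he : G.lab e = Tp.times F) (h : Derivable (G.replace e F) A) :
      Derivable G A
  | times_right {r : ℕ} (M : Graph Tp r) (K : ∀ m : M.E, Graph Tp (M.rk m))
      (hK : ∀ m, Derivable (K m) (M.lab m)) :
      Derivable (M.toSkel.subst K) (Tp.times M)
  | iso {r : ℕ} {H H' : Graph Tp r} {A A' : Tp r} (hH : H.Same H') (hA : Tp.Same A A')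
      (h : Derivable H A) : Derivable H' A'

/-- A hypergraph Lambek grammar over the finite ranked alphabet `C` with a distinguished type
`start` (of rank `r`): `corr` is a finite relation between symbols and types of equal ranks. -/
structure Grammar (C : ℕ → Type v) (r : ℕ) where
  alphabet_finite : Finite (Σ n, C n)
  start : Tp r
  corr : ∀ {n : ℕ}, C n → Tp n → Prop
  corr_finite : {p : Σ n, C n × Tp n | corr p.2.1 p.2.2}.Finite

/-- The hypergraph `f(G)`: all edges are relabelled by `f`. -/
def Graph.relabel {C : ℕ → Type u} {C' : ℕ → Type v} {r : ℕ} (G : Graph C r)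
    (f : ∀ e : G.E, C' (G.rk e)) : Graph C' r where
  toSkel := G.toSkel
  lab := f

/-- The language generated by a hypergraph Lambek grammar. (All its elements have the rank of the
distinguished type, since this is required of a sequent.) -/
def Grammar.language {C : ℕ → Type v} {r : ℕ} (Gr : Grammar C r) : Set (Graph C r) :=
  {G | ∃ f : ∀ e : G.E, Tp (G.rk e),
    (∀ e, Gr.corr (G.lab e) (f e)) ∧ Derivable (G.relabel f) Gr.start}

/-- The ranked alphabet with one symbol, which has rank 2. -/
inductive Star : ℕ → Type
  | star : Star 2

/-- The number of edges whose first attachment node is `v`. -/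
noncomputable def Graph.outdegree {r : ℕ} (G : Graph Star r) (v : G.V) : ℕ :=
  Nat.card {e : G.E // ∃ i : Fin (G.rk e), (i : ℕ) = 0 ∧ G.att e i = v}

/-- The number of edges whose second attachment node is `v`. -/
noncomputable def Graph.indegree {r : ℕ} (G : Graph Star r) (v : G.V) : ℕ :=
  Nat.card {e : G.E // ∃ i : Fin (G.rk e), (i : ℕ) = 1 ∧ G.att e i = v}

/-- A binary graph is regular if, for some `k ≥ 1`, the indegree and the outdegree of every node
are equal to `k`. -/
def Graph.IsRegular {r : ℕ} (G : Graph Star r) : Prop :=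
  ∃ k : ℕ, 1 ≤ k ∧ ∀ v : G.V, G.indegree v = k ∧ G.outdegree v = k

/-- The language of all regular binary graphs (without external nodes) except the empty graph. -/
def regularGraphs : Set (Graph Star 0) :=
  {G | Nonempty G.V ∧ G.IsRegular}

end HL

/-! The grammar cuts an edge from `t` to `h` into three pieces of rank one: two tail halves at `t`,
of types `aTp _` and `cTp _`, and a head at `h`, of type `qTp`. At every node the numbers of `aTp`
halves and of `cTp` halves are then both the outdegree, and the number of heads is the indegree. The
division types arrange all nodes in a chain. At its first node, `cTp` halves and heads are consumed
in pairs; after that, every `aTp` half at a node that is not the last is consumed together with one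
`cTp` half and one head at the next node. So if a node has `j` halves `aTp`, the next one has `j`
halves `cTp` and `j` heads. Since the two kinds of halves are equinumerous at each node, one number
propagates along the whole chain and the graph is regular.

That the grammar generates nothing else is shown by a model, not by an analysis of derivations. A
hypergraph gets a value: the weights of its external nodes and the multiset of the weights of its
inner nodes, a weight being a sum of contributions of incident edges. Values are compatible with
replacement (`value_subst`), so interpreting `÷` as a residual and `×` as an image is sound
(`Derivable.interp_subset`). Weights in `W3` count the three kinds of pieces, and `primInterp`
records what a partly read chain knows: equal counts so far, and the debt that a node leaves to the
next one.

Conversely, a regular graph has at least two nodes; they are put in any order, and the derivation is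
written out from the last node of the chain to the first (`BagDerivable.chain`). To avoid the nested
node sets of iterated replacement, antecedents are described by multisets of edges over a fixed set
(`Rep`, `BagDerivable`). Finally the pieces are reassembled into edges by `×→`
(`derivable_of_stars`). -/

namespace HL

universe u

-- Node weights, and values of hypergraphs under replacement.

attribute [instance] Skel.finV Skel.finE

noncomputable instance Skel.fintypeV {r : ℕ} (M : Skel r) : Fintype M.V := Fintype.ofFinite _

noncomputable instance Skel.fintypeE {r : ℕ} (M : Skel r) : Fintype M.E := Fintype.ofFinite _

theorem glue_ext {r : ℕ} (M : Skel r) (K : ∀ e : M.E, Skel (M.rk e)) (e : M.E)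
    (i : Fin (M.rk e)) : glue M K e ((K e).ext i) = Sum.inl (M.att e i) := by
  have h : (K e).ext i ∈ Set.range (K e).ext := ⟨i, rfl⟩
  change glueFun M K e _ = _
  rw [glueFun, dif_pos h]
  rw [(K e).ext.injective h.choose_spec]

theorem glue_inner {r : ℕ} (M : Skel r) (K : ∀ e : M.E, Skel (M.rk e)) (e : M.E)
    (v : (K e).Inner) : glue M K e v = Sum.inr ⟨e, v⟩ := by
  change glueFun M K e _ = _
  rw [glueFun, dif_neg v.2]

theorem glue_eq_inl {r : ℕ} {M : Skel r} {K : ∀ e : M.E, Skel (M.rk e)} {e : M.E}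
    {w : (K e).V} {v : M.V} :
    glue M K e w = Sum.inl v ↔ ∃ i, M.att e i = v ∧ w = (K e).ext i := by
  constructor
  · intro h
    by_cases hw : w ∈ Set.range (K e).ext
    · obtain ⟨i, rfl⟩ := hw
      rw [glue_ext] at h
      exact ⟨i, Sum.inl.inj h, rfl⟩
    · rw [glue_inner M K e ⟨w, hw⟩] at h
      cases h
  · rintro ⟨i, rfl, rfl⟩
    exact glue_ext ..

theorem glue_eq_inr {r : ℕ} {M : Skel r} {K : ∀ e : M.E, Skel (M.rk e)} {e e' : M.E}
    {w : (K e).V} {v : (K e').Inner} :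
    glue M K e w = Sum.inr ⟨e', v⟩ ↔ ∃ h : e' = e, w = h ▸ v.1 := by
  constructor
  · intro h
    by_cases hw : w ∈ Set.range (K e).ext
    · obtain ⟨i, rfl⟩ := hw
      rw [glue_ext] at h
      cases h
    · rw [glue_inner M K e ⟨w, hw⟩] at h
      cases h
      exact ⟨rfl, rfl⟩
  · rintro ⟨rfl, rfl⟩
    exact glue_inner ..

noncomputable instance Skel.fintypeInner {r : ℕ} (M : Skel r) : Fintype M.Inner :=
  Fintype.ofFinite _

open Classical in
/-- `a` if `p` holds, and `0` otherwise. -/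
noncomputable def gate {B : Type*} [Zero B] (p : Prop) (a : B) : B := if p then a else 0

theorem gate_pos {B : Type*} [Zero B] {p : Prop} (h : p) (a : B) : gate p a = a := if_pos h

theorem gate_neg {B : Type*} [Zero B] {p : Prop} (h : ¬p) (a : B) : gate p a = 0 := if_neg h

theorem gate_zero {B : Type*} [Zero B] (p : Prop) : gate p (0 : B) = 0 := ite_self 0

theorem gate_sum {B ι : Type*} [AddCommMonoid B] (p : Prop) (s : Finset ι) (f : ι → B) :
    gate p (∑ i ∈ s, f i) = ∑ i ∈ s, gate p (f i) := by
  by_cases h : p <;> simp [gate, h]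

/-- Node and edge sets get a `Fintype` instance from finiteness, while sigma, sum, `Option` and
`Fin` types have their own; this passes between the two. -/
theorem sum_univ_inst {B ι : Type*} [AddCommMonoid B] (i₁ i₂ : Fintype ι) (f : ι → B) :
    @Finset.sum ι B _ (@Finset.univ ι i₁) f = @Finset.sum ι B _ (@Finset.univ ι i₂) f := by
  rw [Subsingleton.elim i₁ i₂]

theorem sum_gate_not {B ι : Type*} [AddCommMonoid B] [Fintype ι] (p : ι → Prop)
    [Fintype {i // ¬p i}] (f : ι → B) :
    ∑ i, gate (¬p i) (f i) = ∑ i : {i // ¬p i}, f i := by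
  classical
  refine (@Finset.sum_filter _ _ _ _ (fun i => ¬p i) (fun _ => Classical.propDecidable _)
    f).symm.trans ?_
  exact Finset.sum_subtype _ (by simp) _

/-- Abstract values of hypergraphs: weights of the external nodes and the multiset of the weights
of the other nodes. -/
abbrev Val (A : Type u) : Type u := (ℕ → A) × Multiset A

variable {A : Type u} [AddCommMonoid A]

/-- The weight of a node if the edges have the given values. -/
noncomputable def Skel.weight {r : ℕ} (M : Skel r) (h : M.E → Val A) (v : M.V) : A :=
  ∑ e, ∑ i : Fin (M.rk e), gate (M.att e i = v) ((h e).1 i)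

/-- The value of a hypergraph whose edges have the given values. -/
noncomputable def Skel.value {r : ℕ} (M : Skel r) (h : M.E → Val A) : Val A :=
  (fun i => if hi : i < r then M.weight h (M.ext ⟨i, hi⟩) else 0,
    ∑ e, (h e).2 + ∑ v, gate (v ∉ Set.range M.ext) {M.weight h v})

theorem Skel.value_fst {r : ℕ} (M : Skel r) (h : M.E → Val A) (i : Fin r) :
    (M.value h).1 i = M.weight h (M.ext i) := by
  simp [Skel.value]

theorem Skel.weight_congr {r : ℕ} (M : Skel r) {h h' : M.E → Val A}
    (H : ∀ e (i : Fin (M.rk e)), (h e).1 i = (h' e).1 i) : M.weight h = M.weight h' := by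
  funext v
  simp only [Skel.weight, H]

theorem Skel.value_congr {r : ℕ} (M : Skel r) {h h' : M.E → Val A}
    (H : ∀ e (i : Fin (M.rk e)), (h e).1 i = (h' e).1 i) (H' : ∀ e, (h e).2 = (h' e).2) :
    M.value h = M.value h' := by
  simp only [Skel.value, M.weight_congr H, H']

section Subst

variable {C : ℕ → Type*} {r : ℕ} (M : Skel r) (K : ∀ e : M.E, Graph C (M.rk e))
  (h : (Σ e : M.E, (K e).E) → Val A)

theorem sum_subst_edges {B : Type*} [AddCommMonoid B] (f : (Σ e : M.E, (K e).E) → B) :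
    ∑ p : (M.subst K).E, f p = ∑ e, ∑ e' : (K e).E, f ⟨e, e'⟩ :=
  (sum_univ_inst _ _ f).trans (Fintype.sum_sigma f)

theorem sum_subst_nodes {B : Type*} [AddCommMonoid B]
    (f : (SubstNode M fun e => (K e).toSkel) → B) :
    ∑ p : (M.subst K).V, f p = ∑ v, f (Sum.inl v) +
      ∑ e, ∑ w : (K e).Inner, f (Sum.inr ⟨e, w⟩) :=
  (sum_univ_inst _ _ f).trans ((Fintype.sum_sum_type f).trans
      (congrArg _ (Fintype.sum_sigma fun p : Σ e, (K e).Inner => f (Sum.inr p))))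

theorem weight_subst (v : SubstNode M fun e => (K e).toSkel) :
    (M.subst K).toSkel.weight h v = ∑ e, ∑ e' : (K e).E, ∑ i : Fin ((K e).rk e'),
      gate (glue M (fun e => (K e).toSkel) e ((K e).att e' i) = v) ((h ⟨e, e'⟩).1 i) :=
  sum_subst_edges M K fun p => ∑ i : Fin ((K p.1).rk p.2),
    gate (glue M (fun e => (K e).toSkel) p.1 ((K p.1).att p.2 i) = v) ((h p).1 i)

/-- An edge of `K e` reaches an old node only through an external node of `K e`. The attachment of
`e` and the external sequence are both injective, so each incidence is counted once on either side.
-/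
theorem weight_subst_inl (v : M.V) : (M.subst K).toSkel.weight h (Sum.inl v) =
    M.weight (fun e => (K e).toSkel.value fun e' => h ⟨e, e'⟩) v := by
  refine (weight_subst M K h _).trans ?_
  rw [Skel.weight]
  refine Finset.sum_congr rfl fun e _ => ?_
  simp only [Skel.value_fst, Skel.weight, gate_sum]
  rw [Finset.sum_comm]
  refine Finset.sum_congr rfl fun e' _ => ?_
  rw [Finset.sum_comm]
  refine Finset.sum_congr rfl fun i _ => ?_
  by_cases hg : glue M (fun e => (K e).toSkel) e ((K e).att e' i) = Sum.inl v
  · obtain ⟨j, hj, hj'⟩ := glue_eq_inl.1 hg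
    rw [Finset.sum_eq_single j, gate_pos hg, gate_pos hj, gate_pos hj']
    · intro j' _ hne
      rw [hj', gate_neg (fun h => hne ((K e).ext.injective h).symm), gate_zero]
    · simp
  · rw [gate_neg hg]
    refine (Finset.sum_eq_zero fun j _ => ?_).symm
    by_cases h1 : M.att e j = v
    · rw [gate_pos h1, gate_neg]
      exact fun h2 => hg (glue_eq_inl.2 ⟨j, h1, h2⟩)
    · exact gate_neg h1 _

theorem weight_subst_inr (e : M.E) (v : (K e).Inner) :
    (M.subst K).toSkel.weight h (Sum.inr ⟨e, v⟩) =
    (K e).toSkel.weight (fun e' => h ⟨e, e'⟩) v := by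
  refine (weight_subst M K h _).trans ?_
  rw [Skel.weight, Finset.sum_eq_single e]
  · refine Finset.sum_congr rfl fun e' _ => Finset.sum_congr rfl fun i _ => ?_
    rw [glue_eq_inr (K := fun e => (K e).toSkel)]
    simp
  · intro e₁ _ hne
    refine Finset.sum_eq_zero fun e' _ => Finset.sum_eq_zero fun i _ => gate_neg ?_ _
    rw [glue_eq_inr (K := fun e => (K e).toSkel)]
    exact fun ⟨h, _⟩ => hne h.symm
  · simp

/-- Inner nodes of the result are those of `M`, whose weights depend on `K e` only through its
external weights, and those of each `K e`, whose weights are unchanged. So only the value of `K e`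
matters, which is what makes values a model. -/
theorem value_subst : (M.subst K).toSkel.value h =
    M.value (fun e => (K e).toSkel.value fun e' => h ⟨e, e'⟩) := by
  refine Prod.ext ?_ ?_
  · funext i
    simp only [Skel.value]
    split_ifs with hi
    · exact weight_subst_inl M K h _
    · rfl
  · have e4 : ∀ v : M.V, (Sum.inl v : (M.subst K).V) ∈ Set.range (M.subst K).ext ↔
        v ∈ Set.range M.ext := by
      intro v
      constructor
      · rintro ⟨i, hi⟩
        exact ⟨i, Sum.inl.inj hi⟩
      · rintro ⟨i, rfl⟩
        exact ⟨i, rfl⟩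
    have e5 : ∀ w, (Sum.inr w : (M.subst K).V) ∉ Set.range (M.subst K).ext := by
      rintro w ⟨i, hi⟩
      cases hi
    have e6 : ∀ e, (∑ w : (K e).Inner, gate ((Sum.inr ⟨e, w⟩ : (M.subst K).V) ∉
        Set.range (M.subst K).ext) {(M.subst K).toSkel.weight h (Sum.inr ⟨e, w⟩)} : Multiset A) =
        ∑ w, gate (w ∉ Set.range (K e).ext) {(K e).toSkel.weight (fun e' => h ⟨e, e'⟩) w} := by
      intro e
      refine (Finset.sum_congr rfl fun w _ => ?_).trans (sum_gate_not
        (fun w => w ∈ Set.range (K e).ext) fun w => ({(K e).toSkel.weight _ w} : Multiset A)).symm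
      rw [gate_pos (e5 _)]
      exact congrArg _ (weight_subst_inr M K h e w)
    have e7 : ∀ v, (gate ((Sum.inl v : (M.subst K).V) ∉ Set.range (M.subst K).ext)
        {(M.subst K).toSkel.weight h (Sum.inl v)} : Multiset A) = gate (v ∉ Set.range M.ext)
          {M.weight (fun e => (K e).toSkel.value fun e' => h ⟨e, e'⟩) v} := by
      intro v
      rw [e4]
      exact congrArg _ (congrArg _ (weight_subst_inl M K h v))
    refine (congrArg₂ (· + ·) (sum_subst_edges M K fun p => (h p).2)
      (sum_subst_nodes M K fun v => gate (v ∉ Set.range (M.subst K).ext)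
        {(M.subst K).toSkel.weight h v})).trans ?_
    refine (congrArg₂ (fun a b => _ + (a + b)) (Finset.sum_congr rfl fun v _ => e7 v)
      (Finset.sum_congr rfl fun e _ => e6 e)).trans ?_
    change _ = ∑ e, (∑ e' : (K e).E, (h ⟨e, e'⟩).2 + ∑ w, gate (w ∉ Set.range (K e).ext)
      {(K e).toSkel.weight (fun e' => h ⟨e, e'⟩) w}) + _
    rw [Finset.sum_add_distrib, add_assoc]
    exact congrArg _ (add_comm _ _)

end Subst

theorem Skel.Iso.weight_eq {r : ℕ} {M M' : Skel r} (φ : M.Iso M') (h : M'.E → Val A) (v : M.V) :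
    M'.weight h (φ.onV v) = M.weight (h ∘ φ.onE) v := by
  rw [Skel.weight, Skel.weight, ← Equiv.sum_comp φ.onE]
  refine Finset.sum_congr rfl fun e _ => ?_
  rw [← Equiv.sum_comp (finCongr (φ.rk_eq e))]
  refine Finset.sum_congr rfl fun i _ => ?_
  rw [finCongr_apply, φ.att_eq]
  simp

theorem Skel.Iso.value_eq {r : ℕ} {M M' : Skel r} (φ : M.Iso M') (h : M'.E → Val A) :
    M'.value h = M.value (h ∘ φ.onE) := by
  refine Prod.ext ?_ ?_
  · funext i
    simp only [Skel.value, φ.ext_eq, φ.weight_eq]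
  · simp only [Skel.value]
    rw [← Equiv.sum_comp φ.onE, ← Equiv.sum_comp φ.onV]
    refine congrArg₂ _ rfl (Finset.sum_congr rfl fun v _ => ?_)
    rw [φ.weight_eq]
    simp [φ.ext_eq]

/-- The interpretation of types by sets of values, given one for primitive types. -/
def Tp.interp (I : ℕ → ℕ → Set (Val A)) : ∀ {r : ℕ}, Tp r → Set (Val A)
  | _, .prim r i => I r i
  | _, .div N D lab => {x | ∀ h : D.E → Val A, (∀ d, h d ∈ (lab d).interp I) →
      D.full.value (fun o : Option D.E => o.elim x h) ∈ N.interp I}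
  | _, .prod M lab => {x | ∃ h : M.E → Val A, (∀ m, h m ∈ (lab m).interp I) ∧ M.value h = x}

/-- The set of all values of a hypergraph labelled by types. -/
def Graph.interp (I : ℕ → ℕ → Set (Val A)) {r : ℕ} (G : Graph Tp r) : Set (Val A) :=
  {x | ∃ h : G.E → Val A, (∀ e, h e ∈ (G.lab e).interp I) ∧ G.toSkel.value h = x}

end HL

/-! ### Soundness of the interpretation by sets of values. -/

namespace HL

universe u

variable {A : Type u} [AddCommMonoid A]

/-- The isomorphism of the hypergraphs in which the dollar edges are ordinary edges. -/
def DSkel.fullIso {r k : ℕ} {D D' : DSkel r k} (φ : D.toSkel.Iso D'.toSkel)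
    (hole_eq : ∀ i, D'.hole i = φ.onV (D.hole i)) : D.full.Iso D'.full where
  onV := φ.onV
  onE := Equiv.optionCongr φ.onE
  rk_eq
    | none => rfl
    | some d => φ.rk_eq d
  att_eq
    | none => fun i => hole_eq i
    | some d => fun i => φ.att_eq d i
  ext_eq := φ.ext_eq

theorem Tp.Same.interp_eq (I : ℕ → ℕ → Set (Val A)) {m n : ℕ} {X : Tp m} {Y : Tp n}
    (h : Tp.Same X Y) : X.interp I = Y.interp I := by
  induction h with
  | prim r i => rfl
  | @div r k N N' D D' lab lab' φ hole_eq hN hlab ihN ihlab =>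
    ext x
    simp only [Tp.interp, Set.mem_ofPred_eq, ← ihN]
    have key : ∀ h' : D'.E → Val A, D'.full.value (fun o : Option D'.E => o.elim x h') =
        D.full.value (fun o : Option D.E => o.elim x (h' ∘ φ.onE)) := by
      intro h'
      refine ((DSkel.fullIso φ hole_eq).value_eq _).trans (congrArg _ (funext fun o => ?_))
      cases o <;> rfl
    constructor
    · intro H h' hh'
      rw [key]
      refine H _ fun d => ?_
      rw [ihlab]
      exact hh' _
    · intro H h hh
      have := H (h ∘ φ.onE.symm) fun d => by
        obtain ⟨d, rfl⟩ := φ.onE.surjective d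
        rw [← ihlab]
        simpa using hh d
      rw [key] at this
      simpa [Function.comp_def] using this
  | @prod r M M' lab lab' φ hlab ihlab =>
    ext x
    simp only [Tp.interp, Set.mem_ofPred_eq]
    constructor
    · rintro ⟨h, hh, rfl⟩
      refine ⟨h ∘ φ.onE.symm, fun d => ?_, ?_⟩
      · obtain ⟨d, rfl⟩ := φ.onE.surjective d
        rw [← ihlab]
        simpa using hh d
      · rw [φ.value_eq]
        simp [Function.comp_def]
    · rintro ⟨h, hh, rfl⟩
      refine ⟨h ∘ φ.onE, fun d => ?_, (φ.value_eq h).symm⟩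
      rw [ihlab]
      exact hh _

theorem Graph.Same.interp_eq (I : ℕ → ℕ → Set (Val A)) {r : ℕ} {G H : Graph Tp r}
    (h : G.Same H) : G.interp I = H.interp I := by
  obtain ⟨φ, hφ⟩ := h
  exact (Tp.Same.prod φ hφ).interp_eq I

/-- Two values agree as values of hypergraphs of rank `r`. -/
def Val.Agree (r : ℕ) (x y : Val A) : Prop := (∀ i : Fin r, x.1 i = y.1 i) ∧ x.2 = y.2

/-- Equality can fail: `Skel.value` is `0` at indices beyond the rank, whereas the value given to
the edge is arbitrary there. -/
theorem handle_value_agree {C : ℕ → Type*} {n : ℕ} (a : C n) (h : (handle a).E → Val A) :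
    Val.Agree n ((handle a).toSkel.value h) (h ()) := by
  have hs : ∀ {B : Type u} [AddCommMonoid B] (f : (handle a).E → B), ∑ e, f e = f () := by
    intro B _ f
    exact (sum_univ_inst _ _ f).trans (Fintype.sum_unique (ι := Unit) f)
  constructor
  · intro i
    refine (Skel.value_fst _ _ i).trans ((hs _).trans ?_)
    refine (Finset.sum_eq_single i ?_ ?_).trans ?_
    · intro j _ hj
      exact gate_neg hj _
    · exact fun h => absurd (Finset.mem_univ _) h
    · exact gate_pos rfl _
  · refine (congrArg₂ (· + ·) (hs _) (Finset.sum_eq_zero fun v _ => ?_)).trans (add_zero _)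
    exact gate_neg (not_not_intro ⟨v, rfl⟩) _

theorem exists_value_of_mem_interp_subst {I : ℕ → ℕ → Set (Val A)} {r : ℕ} {M : Skel r}
    {K : ∀ e : M.E, Graph Tp (M.rk e)} {S : M.E → Set (Val A)}
    (hK : ∀ e, ∀ x ∈ (K e).interp I, ∃ y ∈ S e, Val.Agree (M.rk e) x y) {x : Val A}
    (hx : x ∈ (M.subst K).interp I) : ∃ y : M.E → Val A, (∀ e, y e ∈ S e) ∧ M.value y = x := by
  obtain ⟨h, hh, rfl⟩ := hx
  choose y hy hy' using fun e => hK e _ ⟨fun e' => h ⟨e, e'⟩, fun e' => hh ⟨e, e'⟩, rfl⟩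
  refine ⟨y, hy, ?_⟩
  refine Eq.trans ?_ (value_subst M K h).symm
  exact (M.value_congr (fun e i => (hy' e).1 i) fun e => (hy' e).2).symm

theorem mem_interp_subst {I : ℕ → ℕ → Set (Val A)} {r : ℕ} {M : Skel r}
    {K : ∀ e : M.E, Graph Tp (M.rk e)} (y : M.E → Val A)
    (hy : ∀ e, ∃ x ∈ (K e).interp I, Val.Agree (M.rk e) x (y e)) :
    M.value y ∈ (M.subst K).interp I := by
  choose x hx hxy using hy
  choose h hh hx using hx
  refine ⟨fun p : Σ e, (K e).E => h p.1 p.2, fun p => hh _ _, ?_⟩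
  refine (value_subst M K _).trans ?_
  refine M.value_congr (fun e i => ?_) fun e => ?_
  · exact (congrArg (fun z : Val A => z.1 i) (hx e)).trans ((hxy e).1 i)
  · exact (congrArg Prod.snd (hx e)).trans (hxy e).2

theorem exists_agree_of_mem_interp_handle {I : ℕ → ℕ → Set (Val A)} {n : ℕ} {T : Tp n}
    {x : Val A} (hx : x ∈ (handle T).interp I) : ∃ y ∈ T.interp I, Val.Agree n x y := by
  obtain ⟨h, hh, rfl⟩ := hx
  exact ⟨h (), hh (), handle_value_agree T h⟩

theorem exists_agree_mem_interp_handle {I : ℕ → ℕ → Set (Val A)} {n : ℕ} {T : Tp n}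
    {y : Val A} (hy : y ∈ T.interp I) : ∃ x ∈ (handle T).interp I, Val.Agree n x y :=
  ⟨_, ⟨fun _ => y, fun _ => hy, rfl⟩, handle_value_agree T fun _ => y⟩

theorem interp_replace_subset {I : ℕ → ℕ → Set (Val A)} {r : ℕ} {G : Graph Tp r} {e₀ : G.E}
    {K : Graph Tp (G.rk e₀)} (hK : K.interp I ⊆ (G.lab e₀).interp I) :
    (G.replace e₀ K).interp I ⊆ G.interp I := by
  intro x hx
  refine exists_value_of_mem_interp_subst (S := fun e => (G.lab e).interp I) (fun e x hx => ?_) hx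
  classical
  by_cases he : e = e₀
  · subst he
    rw [Function.update_self] at hx
    exact ⟨x, hK hx, fun _ => rfl, rfl⟩
  · rw [Function.update_of_ne he] at hx
    exact exists_agree_of_mem_interp_handle hx

theorem subset_interp_replace {I : ℕ → ℕ → Set (Val A)} {r : ℕ} {G : Graph Tp r} {e₀ : G.E}
    {K : Graph Tp (G.rk e₀)} (hK : (G.lab e₀).interp I ⊆ K.interp I) :
    G.interp I ⊆ (G.replace e₀ K).interp I := by
  rintro _ ⟨h, hh, rfl⟩
  refine mem_interp_subst h fun e => ?_
  classical
  by_cases he : e = e₀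
  · subst he
    rw [Function.update_self]
    exact ⟨_, hK (hh e), fun _ => rfl, rfl⟩
  · rw [Function.update_of_ne he]
    exact exists_agree_mem_interp_handle (hh e)

/-- By `value_subst`, `÷` is interpreted as the residual and `×` as the image of the operation of
filling a hypergraph with values, so each rule becomes an inclusion of sets. The hypothesis `hI` is
needed for the axioms, because handles reproduce values only up to `Val.Agree`. -/
theorem Derivable.interp_subset {I : ℕ → ℕ → Set (Val A)}
    (hI : ∀ r i x y, Val.Agree r x y → x ∈ I r i → y ∈ I r i) {r : ℕ} {H : Graph Tp r} {T : Tp r}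
    (h : Derivable H T) : H.interp I ⊆ T.interp I := by
  induction h with
  | ax r i =>
    intro x hx
    obtain ⟨y, hy, hxy⟩ := exists_agree_of_mem_interp_handle hx
    exact hI r i y x ⟨fun j => (hxy.1 j).symm, hxy.2.symm⟩ hy
  | div_left H T e D lab K hH hK ihH ihK =>
    refine (interp_replace_subset fun x hx => ?_).trans ihH
    obtain ⟨y, hy, rfl⟩ := exists_value_of_mem_interp_subst
      (S := fun o : Option D.E => o.elim ((Tp.div (H.lab e) D lab).interp I)
        fun d => (lab d).interp I) (fun o x hx => by
          cases o with
          | none => exact exists_agree_of_mem_interp_handle hx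
          | some d => exact ⟨x, ihK d hx, fun _ => rfl, rfl⟩) hx
    have hy₀ := hy none (fun d => y (some d)) fun d => hy (some d)
    have hy₁ : y = fun o : Option D.E => o.elim (y none) fun d => y (some d) := by
      funext o
      cases o <;> rfl
    rwa [← hy₁] at hy₀
  | div_right F N D lab _ ih =>
    intro x hx h hh
    refine ih (mem_interp_subst _ fun o => ?_)
    cases o with
    | none => exact ⟨x, hx, fun _ => rfl, rfl⟩
    | some d => exact exists_agree_mem_interp_handle (hh d)
  | times_left G T e F he _ ih =>
    exact (subset_interp_replace (he ▸ fun x hx => hx)).trans ih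
  | times_right M K _ ih =>
    intro x hx
    exact exists_value_of_mem_interp_subst (S := fun e => (M.lab e).interp I)
      (fun e x hx => ⟨x, ih e hx, fun _ => rfl, rfl⟩) hx
  | iso hH hT _ ih => rwa [← hH.interp_eq I, ← hT.interp_eq I]

end HL

/-! ### The types of the grammar. -/

namespace HL

universe u

/-- A labelled hyperedge on the set of nodes `V`. -/
abbrev TpEdge (V : Type) : Type 1 := Σ k, (Fin k ↪ V) × Tp k

/-- The hypergraph with the nodes `Fin m` and the given edges. -/
def finSkel {m n r : ℕ} (ext : Fin r ↪ Fin m) (l : Fin n → TpEdge (Fin m)) : Skel r where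
  V := Fin m
  E := Fin n
  finV := inferInstance
  finE := inferInstance
  rk d := (l d).1
  att d := (l d).2.1
  ext := ext

/-- The type `N ÷ D`, where `D` has the nodes `Fin m`, the edges `l` and a dollar edge attached
to `hole`. -/
def divFin {m n r k : ℕ} (N : Tp r) (ext : Fin r ↪ Fin m) (hole : Fin k ↪ Fin m)
    (l : Fin n → TpEdge (Fin m)) : Tp k :=
  Tp.div N { finSkel ext l with hole := hole } fun d => (l d).2.2

/-- The type `×(M)`, where `M` has the nodes `Fin m` and the edges `l`. -/
def timesFin {m n r : ℕ} (ext : Fin r ↪ Fin m) (l : Fin n → TpEdge (Fin m)) : Tp r :=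
  Tp.times { finSkel ext l with lab := fun d => (l d).2.2 }

/-- The attachment sequence of an edge of rank one. -/
def single {V : Type} (v : V) : Fin 1 ↪ V := ⟨fun _ => v, Function.injective_of_subsingleton _⟩

/-- The attachment sequence of an edge of rank two. -/
def pair {V : Type} (u v : V) (h : u ≠ v) : Fin 2 ↪ V :=
  ⟨![u, v], by intro i j; fin_cases i <;> fin_cases j <;> simp [h, h.symm]⟩

@[simp]
theorem single_apply {V : Type} (v : V) (i : Fin 1) : single v i = v := rfl

@[simp]
theorem pair_zero {V : Type} (u v : V) (h : u ≠ v) : pair u v h 0 = u := rfl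

@[simp]
theorem pair_one {V : Type} (u v : V) (h : u ≠ v) : pair u v h 1 = v := rfl

@[simp]
theorem range_single {V : Type} (v : V) : Set.range (single v) = {v} := by
  ext w
  simp [single, eq_comm]

@[simp]
theorem range_pair {V : Type} (u v : V) (h : u ≠ v) : Set.range (pair u v h) = {u, v} := by
  exact Matrix.range_cons_cons_empty u v ![]

section Interp

variable {A : Type u} [AddCommMonoid A]

/-- What an edge of value `y` adds to the weight of a node. -/
noncomputable def contrib {V : Type} {k : ℕ} (att : Fin k ↪ V) (y : Val A) (v : V) : A :=
  ∑ i, gate (att i = v) (y.1 i)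

@[simp]
theorem contrib_single {V : Type} (u v : V) (y : Val A) :
    contrib (single u) y v = gate (u = v) (y.1 0) := by
  simp [contrib, single]

@[simp]
theorem contrib_pair {V : Type} (u u' v : V) (h : u ≠ u') (y : Val A) :
    contrib (pair u u' h) y v = gate (u = v) (y.1 0) + gate (u' = v) (y.1 1) := by
  exact Fin.sum_univ_two _

theorem value_finSkel {m n r : ℕ} (ext : Fin r ↪ Fin m) (l : Fin n → TpEdge (Fin m))
    (h : Fin n → Val A) : (finSkel ext l).value h =
      (fun i => if hi : i < r then ∑ d, contrib (l d).2.1 (h d) (ext ⟨i, hi⟩) else 0,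
        ∑ d, (h d).2 + ∑ v, gate (v ∉ Set.range ext) {∑ d, contrib (l d).2.1 (h d) v}) := by
  have hw : ∀ v, (finSkel ext l).weight h v = ∑ d, contrib (l d).2.1 (h d) v :=
    fun v => sum_univ_inst _ _ fun d => contrib (l d).2.1 (h d) v
  refine Prod.ext (funext fun i => ?_) (congrArg₂ (· + ·) ?_ ?_)
  · simp only [hw, Skel.value]
    rfl
  · exact sum_univ_inst _ _ fun d => (h d).2
  · simp only [hw]
    exact sum_univ_inst _ _ fun v => gate (v ∉ Set.range ext) {∑ d, contrib (l d).2.1 (h d) v}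

theorem mem_interp_timesFin {I : ℕ → ℕ → Set (Val A)} {m n r : ℕ} {ext : Fin r ↪ Fin m}
    {l : Fin n → TpEdge (Fin m)} {x : Val A} : x ∈ (timesFin ext l).interp I ↔
      ∃ h : Fin n → Val A, (∀ d, h d ∈ (l d).2.2.interp I) ∧
        (fun i => if hi : i < r then ∑ d, contrib (l d).2.1 (h d) (ext ⟨i, hi⟩) else 0,
        ∑ d, (h d).2 + ∑ v, gate (v ∉ Set.range ext) {∑ d, contrib (l d).2.1 (h d) v}) = x := by
  simp only [← value_finSkel]
  rfl

theorem mem_interp_divFin {I : ℕ → ℕ → Set (Val A)} {m n r k : ℕ} {N : Tp r}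
    {ext : Fin r ↪ Fin m} {hole : Fin k ↪ Fin m} {l : Fin n → TpEdge (Fin m)} {x : Val A} :
    x ∈ (divFin N ext hole l).interp I ↔
      ∀ h : Fin n → Val A, (∀ d, h d ∈ (l d).2.2.interp I) →
        ((fun i => if hi : i < r then contrib hole x (ext ⟨i, hi⟩) +
          ∑ d, contrib (l d).2.1 (h d) (ext ⟨i, hi⟩) else 0,
        x.2 + ∑ d, (h d).2 + ∑ v, gate (v ∉ Set.range ext)
          {contrib hole x v + ∑ d, contrib (l d).2.1 (h d) v}) : Val A) ∈ N.interp I := by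
  refine forall₂_congr fun (h : Fin n → Val A) hh => ?_
  set D : DSkel r k := { finSkel ext l with hole := hole }
  set h' : D.full.E → Val A := fun o : Option (Fin n) => o.elim x h
  have hs : ∀ {B : Type u} [AddCommMonoid B] (f : Option (Fin n) → B),
      ∑ e : D.full.E, f e = f none + ∑ d, f (some d) :=
    fun f => (sum_univ_inst _ _ f).trans (Fintype.sum_option f)
  have hw : ∀ v, D.full.weight h' v = contrib hole x v + ∑ d, contrib (l d).2.1 (h d) v :=
    fun v => hs fun o => ∑ i : Fin (D.full.rk o), gate (D.full.att o i = v) ((h' o).1 i)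
  have hv : D.full.value h' = (fun i => if hi : i < r then contrib hole x (ext ⟨i, hi⟩) +
      ∑ d, contrib (l d).2.1 (h d) (ext ⟨i, hi⟩) else 0,
      x.2 + ∑ d, (h d).2 + ∑ v, gate (v ∉ Set.range ext)
        {contrib hole x v + ∑ d, contrib (l d).2.1 (h d) v}) := by
    refine Prod.ext (funext fun i => ?_) (congrArg₂ (· + ·) (hs fun o => (h' o).2) ?_)
    · simp only [hw, Skel.value]
      rfl
    · simp only [hw]
      exact sum_univ_inst _ _ fun v => gate (v ∉ Set.range ext)
        {contrib hole x v + ∑ d, contrib (l d).2.1 (h d) v}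
  change D.full.value h' ∈ N.interp I ↔ _
  rw [hv]

end Interp

/-- The primitive type of one of the two halves of an outgoing half-edge. -/
def bTp : Tp 1 := Tp.prim 1 0

/-- The primitive type of an ingoing half-edge. -/
def qTp : Tp 1 := Tp.prim 1 1

/-- The primitive type of the first node of a chain. -/
def uTp : Tp 1 := Tp.prim 1 2

/-- The primitive type of the last node of a chain. -/
def zTp : Tp 1 := Tp.prim 1 3

/-- The primitive type of a chain ending with two given nodes. -/
def yTp : Tp 2 := Tp.prim 2 0

/-- An edge of rank one. -/
abbrev edge₁ {V : Type} (v : V) (T : Tp 1) : TpEdge V := ⟨1, single v, T⟩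

/-- An edge of rank two. -/
abbrev edge₂ {V : Type} (u v : V) (h : u ≠ v) (T : Tp 2) : TpEdge V := ⟨2, pair u v h, T⟩

/-- Types of the other half of an outgoing half-edge. -/
def aTp : Fin 5 → Tp 1 := ![
  divFin (m := 2) yTp (pair 0 1 (by decide)) (single 0)
    ![edge₁ 0 uTp, edge₁ 1 bTp, edge₁ 1 qTp],
  divFin (m := 2) yTp (pair 0 1 (by decide)) (single 0)
    ![edge₂ 0 1 (by decide) yTp, edge₁ 1 bTp, edge₁ 1 qTp],
  divFin (m := 3) yTp (pair 0 1 (by decide)) (single 0)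
    ![edge₂ 2 0 (by decide) yTp, edge₁ 1 bTp, edge₁ 1 qTp],
  divFin (m := 2) zTp (single 0) (single 0) ![edge₂ 1 0 (by decide) yTp],
  divFin (m := 1) zTp (single 0) (single 0) ![edge₁ 0 zTp]]

/-- Types of the first half of an outgoing half-edge. -/
def cTp : Fin 3 → Tp 1 := ![
  bTp,
  divFin (m := 1) uTp (single 0) (single 0) ![edge₁ 0 qTp],
  divFin (m := 1) uTp (single 0) (single 0) ![edge₁ 0 uTp, edge₁ 0 qTp]]

/-- The types of the symbol of rank two. -/
def starTp (p : Fin 5 × Fin 3) : Tp 2 :=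
  timesFin (m := 2) (pair 0 1 (by decide)) ![edge₁ 0 (aTp p.1), edge₁ 0 (cTp p.2), edge₁ 1 qTp]

/-- The distinguished type. -/
def startTp : Tp 0 :=
  timesFin (m := 1) ⟨Fin.elim0, fun i => i.elim0⟩ ![edge₁ 0 zTp]

/-- The correspondence between symbols and types. -/
def starCorr : ∀ {n : ℕ}, Star n → Tp n → Prop
  | _, .star, T => ∃ p, T = starTp p

/-- A grammar of the language of all regular graphs. -/
def regularGrammar : Grammar Star 0 where
  alphabet_finite := Set.finite_univ_iff.1
    ((Set.finite_singleton (⟨2, .star⟩ : Σ n, Star n)).subset fun ⟨_, .star⟩ _ => rfl)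
  start := startTp
  corr := starCorr
  corr_finite := (Set.finite_range fun p => (⟨2, .star, starTp p⟩ : Σ n, Star n × Tp n)).subset
    fun ⟨_, .star, T⟩ ⟨p, hp⟩ => ⟨p, by change T = _ at hp; rw [hp]⟩

/-! ### The counting model: every generated graph is regular. -/

/-- The weights of a node: the numbers of the halves of outgoing half-edges of both kinds and the
number of ingoing half-edges. -/
abbrev W3 : Type := ℕ × ℕ × ℕ

/-- If all weights are those of nodes of a graph, then all of them are equal to `(i, i, i)`. -/
def Uniform (i : ℕ) (μ : Multiset W3) : Prop :=
  (∀ w ∈ μ, w.1 = w.2.1) → ∀ w ∈ μ, w = (i, i, i)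

theorem Uniform.zero (i : ℕ) : Uniform i 0 := fun _ w hw => by simp at hw

/-- This is the moment when the chain leaves a node: balance of its two kinds of halves forces `j =
i`, so the count handed to the next node is the old one. -/
theorem Uniform.add {i j : ℕ} {μ : Multiset W3} (h : Uniform i μ) :
    Uniform j (μ + {(j, i, i)}) := by
  intro hb w hw
  have hji : j = i := hb (j, i, i) (by simp)
  subst hji
  rcases Multiset.mem_add.1 hw with hw | hw
  · exact h (fun w hw => hb w (by simp [hw])) w hw
  · simpa using hw

/-- The interpretation of the primitive types. -/
def primInterp : ℕ → ℕ → Set (Val W3)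
  | 1, 0 => {x | x.1 0 = (0, 1, 0) ∧ x.2 = 0}
  | 1, 1 => {x | x.1 0 = (0, 0, 1) ∧ x.2 = 0}
  | 1, 2 => {x | ∃ j, 1 ≤ j ∧ x.1 0 = (0, j, j) ∧ x.2 = 0}
  | 1, 3 => {x | ∃ i j, 1 ≤ i ∧ x.1 0 = (j, i, i) ∧ Uniform i x.2}
  | 2, 0 => {x | ∃ i j, 1 ≤ i ∧ 1 ≤ j ∧ x.1 0 = (j, i, i) ∧ x.1 1 = (0, j, j) ∧ Uniform i x.2}
  | _, _ => Set.univ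

theorem primInterp_agree (r i : ℕ) (x y : Val W3) (h : Val.Agree r x y)
    (hx : x ∈ primInterp r i) : y ∈ primInterp r i := by
  unfold primInterp at hx ⊢
  split at hx
  · simpa [← h.2, ← show x.1 0 = y.1 0 from h.1 0] using hx
  · simpa [← h.2, ← show x.1 0 = y.1 0 from h.1 0] using hx
  · simpa [← h.2, ← show x.1 0 = y.1 0 from h.1 0] using hx
  · simpa [← h.2, ← show x.1 0 = y.1 0 from h.1 0] using hx
  · simpa [← h.2, ← show x.1 0 = y.1 0 from h.1 0, ← show x.1 1 = y.1 1 from h.1 1] using hx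
  · trivial

/-- The value of an edge of rank one. -/
def unitVal (w : W3) : Val W3 := (fun i => if i = 0 then w else 0, 0)

/-- The value of the symbol of rank two. -/
def starVal : Val W3 := (fun i => if i = 0 then (1, 1, 0) else if i = 1 then (0, 0, 1) else 0, 0)

theorem unitVal_mem_bTp : unitVal (0, 1, 0) ∈ bTp.interp primInterp := by
  simp [bTp, Tp.interp, primInterp, unitVal]

theorem unitVal_mem_qTp : unitVal (0, 0, 1) ∈ qTp.interp primInterp := by
  simp [qTp, Tp.interp, primInterp, unitVal]

theorem unitVal_mem_cTp (j : Fin 3) : unitVal (0, 1, 0) ∈ (cTp j).interp primInterp := by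
  fin_cases j
  · exact unitVal_mem_bTp
  · simp [cTp, mem_interp_divFin, gate, unitVal, uTp, qTp, Tp.interp, primInterp]
    intro h h₀ h₀'
    exact ⟨1, by simp [h₀, h₀']⟩
  · simp [cTp, mem_interp_divFin, gate, unitVal, uTp, qTp, Tp.interp, primInterp,
      Fin.forall_fin_succ, Fin.sum_univ_succ]
    intro h j hj h₀ h₀' h₁ h₁'
    exact ⟨j + 1, by simp [h₀, h₀', h₁, h₁', add_comm]⟩

/-- In a chain value, `i` is the number of first halves and of heads at the current node, and `j` is
the number of its `aTp` halves read so far, hence also of the pairs already read at the next node.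
Types 0, 1 and 2 increase `j` or start it at 1; types 2 and 3 move on, turning the former current
node into an inner node of weight `(j, i, i)`, which is where `Uniform.add` enters. Type 4 increases
`j` at the last node. -/
theorem unitVal_mem_aTp (j : Fin 5) : unitVal (1, 0, 0) ∈ (aTp j).interp primInterp := by
  fin_cases j <;>
    simp [aTp, mem_interp_divFin, gate, unitVal, uTp, yTp, bTp, qTp, zTp, Tp.interp, primInterp,
      Fin.forall_fin_succ, Fin.sum_univ_succ]
  · intro h i hi h₀ h₀' h₁ h₁' h₂ h₂'
    exact ⟨i, hi, 1, le_rfl, by simp [h₀, h₀', h₁, h₁', h₂, h₂', Uniform.zero]⟩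
  · intro h i hi j hj h₀ h₀' hμ h₁ h₁' h₂ h₂'
    exact ⟨i, hi, j + 1, by simp [h₀, h₀', h₁, h₁', h₂, h₂', hμ, add_comm]⟩
  · intro h i hi j hj h₀ h₀' hμ h₁ h₁' h₂ h₂'
    exact ⟨j, hj, 1, le_rfl, by simp [h₀, h₀', h₁, h₁', h₂, h₂', hμ.add]⟩
  · intro h i hi j hj h₀ h₀' hμ
    exact ⟨j, hj, by simp [h₀, h₀', hμ.add]⟩
  · intro h i hi j h₀ hμ
    exact ⟨i, hi, by simp [h₀, hμ]⟩

theorem starVal_mem_starTp (p : Fin 5 × Fin 3) : starVal ∈ (starTp p).interp primInterp := by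
  rw [starTp, mem_interp_timesFin]
  refine ⟨![unitVal (1, 0, 0), unitVal (0, 1, 0), unitVal (0, 0, 1)], ?_, ?_⟩
  · intro d
    fin_cases d
    exacts [unitVal_mem_aTp p.1, unitVal_mem_cTp p.2, unitVal_mem_qTp]
  · refine Prod.ext (funext fun i => ?_) ?_
    · rcases i with _ | _ | i
      · simp [starVal, unitVal, gate, Fin.sum_univ_succ]
      · simp [starVal, unitVal, gate, Fin.sum_univ_succ]
      · simp [starVal]
    · simp [starVal, unitVal, gate, Fin.sum_univ_succ]

theorem uniform_of_mem_startTp {x : Val W3} (hx : x ∈ startTp.interp primInterp) :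
    x.2 ≠ 0 ∧ ∃ i, 1 ≤ i ∧ Uniform i x.2 := by
  rw [startTp, mem_interp_timesFin] at hx
  obtain ⟨h, hh, rfl⟩ := hx
  obtain ⟨i, j, hi, h₀, hμ⟩ := hh 0
  simp [gate]
  refine ⟨i, hi, ?_⟩
  change (h 0).1 0 = _ at h₀
  rw [h₀]
  intro hb w hw
  -- The last node of the chain is inner in the start type, so it must be balanced too.
  have hji : j = i := hb (j, i, i) (by simp)
  subst hji
  exact hμ.add hb w hw

theorem starVal_mem {n : ℕ} (a : Star n) (T : Tp n) (h : starCorr a T) :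
    starVal ∈ T.interp primInterp := by
  cases a
  obtain ⟨p, rfl⟩ := h
  exact starVal_mem_starTp p

/-- The first two coordinates coincide, so the balance premise of `Uniform` holds automatically for
the values of graphs over `Star`. -/
theorem weight_starVal {r : ℕ} (G : Graph Star r) (v : G.V) :
    G.toSkel.weight (fun _ => starVal) v = (G.outdegree v, G.outdegree v, G.indegree v) := by
  classical
  have key : ∀ j : ℕ, Nat.card {e : G.E // ∃ i : Fin (G.rk e), (i : ℕ) = j ∧ G.att e i = v} =
      ∑ e, ∑ i : Fin (G.rk e), if (i : ℕ) = j ∧ G.att e i = v then 1 else 0 := by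
    intro j
    rw [Nat.card_eq_fintype_card, Fintype.card_subtype, Finset.card_filter]
    refine Finset.sum_congr rfl fun e _ => ?_
    split_ifs with h
    · obtain ⟨i, hi⟩ := h
      rw [Finset.sum_eq_single i, if_pos hi]
      · intro i' _ hne
        exact if_neg fun h' => hne (Fin.ext (h'.1.trans hi.1.symm))
      · simp
    · exact (Finset.sum_eq_zero fun i _ => if_neg fun hi => h ⟨i, hi⟩).symm
  rw [Graph.outdegree, Graph.indegree, key, key, Skel.weight]
  simp only [Prod.ext_iff, Prod.fst_sum, Prod.snd_sum]
  refine ⟨?_, ?_, ?_⟩ <;>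
  · refine Finset.sum_congr rfl fun e _ => Finset.sum_congr rfl fun i _ => ?_
    by_cases h : G.att e i = v <;> by_cases h0 : (i : ℕ) = 0 <;> by_cases h1 : (i : ℕ) = 1 <;>
      simp [gate, starVal, h, h0, h1]

theorem language_subset : regularGrammar.language ⊆ regularGraphs := by
  rintro G ⟨f, hf, hd⟩
  have hx := hd.interp_subset primInterp_agree
    ⟨fun _ => starVal, fun e => starVal_mem (G.lab e) (f e) (hf e), rfl⟩
  obtain ⟨hne, i, hi, hu⟩ := uniform_of_mem_startTp hx
  -- In rank 0 every node is inner, and `starVal` itself contributes no inner nodes.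
  have hμ : (G.toSkel.value fun _ => starVal).2 = (∑ v, {G.toSkel.weight (fun _ => starVal) v}) := by
    refine (congrArg₂ (· + ·) (Finset.sum_eq_zero fun e _ => rfl)
      (Finset.sum_congr rfl fun v _ => gate_pos ?_ _)).trans (zero_add _)
    rintro ⟨i, -⟩
    exact i.elim0
  change (G.toSkel.value fun _ => starVal).2 ≠ 0 at hne
  change Uniform i (G.toSkel.value fun _ => starVal).2 at hu
  rw [hμ] at hne hu
  have hmem : ∀ w, w ∈ (∑ v, {G.toSkel.weight (fun _ => starVal) v} : Multiset W3) ↔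
      ∃ v, w = G.toSkel.weight (fun _ => starVal) v := by
    intro w
    rw [Multiset.mem_sum]
    simp
  constructor
  · by_contra h
    rw [not_nonempty_iff] at h
    exact hne (Finset.sum_eq_zero fun v _ => h.elim v)
  · refine ⟨i, hi, fun v => ?_⟩
    have := hu (fun w hw => by
      obtain ⟨v, rfl⟩ := (hmem w).1 hw
      rw [weight_starVal]) _ ((hmem _).2 ⟨v, rfl⟩)
    rw [weight_starVal] at this
    simp only [Prod.mk.injEq] at this
    exact ⟨this.2.2, this.1⟩

end HL

/-! ### Hypergraphs up to isomorphism as multisets of edges. -/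

namespace HL

/-- Corresponding fibres of `f` and `g` have the same cardinality; bijections between them are glued
together. -/
theorem exists_equiv_of_map_univ_eq {E E' X : Type*} [Fintype E] [Fintype E'] {f : E → X}
    {g : E' → X} (h : (Finset.univ.val.map f : Multiset X) = Finset.univ.val.map g) :
    ∃ φ : E ≃ E', ∀ e, g (φ e) = f e := by
  classical
  have hc : ∀ x, Nonempty ({e // f e = x} ≃ {e // g e = x}) := by
    refine fun x => Fintype.card_eq.1 ?_
    have := congrArg (Multiset.count x) h
    rw [Multiset.count_map, Multiset.count_map] at this
    rw [Fintype.card_subtype, Fintype.card_subtype]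
    simpa only [eq_comm, Finset.card_def, Finset.filter_val] using this
  have ψ := fun x => (hc x).some
  refine ⟨(Equiv.sigmaFiberEquiv f).symm.trans
    ((Equiv.sigmaCongrRight fun x => ψ x).trans (Equiv.sigmaFiberEquiv g)), fun e => ?_⟩
  exact (ψ (f e) ⟨e, rfl⟩).2

theorem Tp.Same.refl : ∀ {n : ℕ} (T : Tp n), Tp.Same T T := by
  intro n T
  induction T with
  | prim r i => exact .prim r i
  | div N D lab ihN ihlab =>
    exact .div ⟨Equiv.refl _, Equiv.refl _, fun _ => rfl, fun _ _ => rfl, fun _ => rfl⟩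
      (fun _ => rfl) ihN ihlab
  | prod M lab ih =>
    exact .prod ⟨Equiv.refl _, Equiv.refl _, fun _ => rfl, fun _ _ => rfl, fun _ => rfl⟩ ih

/-- An edge labelled by a type and attached to a sequence of elements of `W`. -/
abbrev SeqEdge (W : Type) : Type 1 := Σ n, (Fin n → W) × Tp n

variable {W : Type}

/-- The multiset of the edges of a hypergraph whose nodes are mapped to `W`. -/
noncomputable def Graph.bag {r : ℕ} (G : Graph Tp r) (ν : G.V → W) : Multiset (SeqEdge W) :=
  ∑ e, {⟨G.rk e, ν ∘ G.att e, G.lab e⟩}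

theorem Graph.bag_eq_map {r : ℕ} (G : Graph Tp r) (ν : G.V → W) :
    G.bag ν = Finset.univ.val.map fun e => (⟨G.rk e, ν ∘ G.att e, G.lab e⟩ : SeqEdge W) := by
  rw [← Multiset.sum_map_singleton (Multiset.map _ _), Multiset.map_map]
  rfl

/-- `G` is, up to isomorphism, the hypergraph with the set of nodes `s` and the multiset of
edges `m`. -/
def Rep (G : Graph Tp 0) (s : Set W) (m : Multiset (SeqEdge W)) : Prop :=
  ∃ ν : G.V → W, Function.Injective ν ∧ Set.range ν = s ∧ G.bag ν = m

/-- The common names in `W` match the nodes, and equality of multisets matches the edges. Hence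
derivability may be transferred between any two graphs with the same description. -/
theorem Rep.same {G H : Graph Tp 0} {s : Set W} {m : Multiset (SeqEdge W)} (hG : Rep G s m)
    (hH : Rep H s m) : G.Same H := by
  obtain ⟨ν, hν, rfl, rfl⟩ := hG
  obtain ⟨κ, hκ, hr, hb⟩ := hH
  rw [Graph.bag_eq_map, Graph.bag_eq_map] at hb
  obtain ⟨φ, hφ⟩ := exists_equiv_of_map_univ_eq hb.symm
  let ψ : G.V ≃ H.V := (Equiv.ofInjective ν hν).trans
    ((Equiv.setCongr hr.symm).trans (Equiv.ofInjective κ hκ).symm)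
  have hψ : ∀ v, κ (ψ v) = ν v := fun v => Equiv.apply_ofInjective_symm hκ _
  have key : ∀ x y : SeqEdge W, x = y → ∃ h : y.1 = x.1,
      (∀ i, x.2.1 (Fin.cast h i) = y.2.1 i) ∧ Tp.Same y.2.2 x.2.2 := by
    rintro x _ rfl
    exact ⟨rfl, fun _ => rfl, .refl _⟩
  choose hrk hatt hlab using fun e => key _ _ (hφ e)
  refine ⟨⟨ψ, φ, hrk, fun e i => hκ ?_, fun i => i.elim0⟩, hlab⟩
  rw [hψ]
  exact hatt e i

/-- The hypotheses on the names express disjointness: external nodes of `K e` bear the names of the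
nodes they are fused with, and inner ones have names used neither in `M` nor by inner nodes of
another `K e'`. -/
theorem exists_map_subst {r : ℕ} {M : Skel r} {K : ∀ e : M.E, Graph Tp (M.rk e)} {ν : M.V → W}
    (hν : Function.Injective ν) {κ : ∀ e, (K e).V → W} (hκ : ∀ e, Function.Injective (κ e))
    (hext : ∀ e i, κ e ((K e).ext i) = ν (M.att e i))
    (hinl : ∀ e w, w ∉ Set.range (K e).ext → κ e w ∉ Set.range ν)
    (hinr : ∀ e e' w w', w ∉ Set.range (K e).ext → w' ∉ Set.range (K e').ext →
      κ e w = κ e' w' → e = e') :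
    ∃ μ : (M.subst K).V → W, Function.Injective μ ∧
      Set.range μ = Set.range ν ∪ ⋃ e, Set.range (κ e) ∧
      (M.subst K).bag μ = ∑ e, (K e).bag (κ e) ∧ ∀ i, μ ((M.subst K).ext i) = ν (M.ext i) := by
  let μ : (SubstNode M fun e => (K e).toSkel) → W := Sum.elim ν fun p => κ p.1 p.2.1
  have hμ : ∀ e w, μ (glue M (fun e => (K e).toSkel) e w) = κ e w := by
    intro e w
    by_cases hw : w ∈ Set.range (K e).ext
    · obtain ⟨i, rfl⟩ := hw
      rw [glue_ext M (fun e => (K e).toSkel), hext]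
      rfl
    · rw [glue_inner M (fun e => (K e).toSkel) e ⟨w, hw⟩]
      rfl
  refine ⟨μ, ?_, ?_, ?_, fun i => rfl⟩
  · rintro (v | ⟨e, w⟩) (v' | ⟨e', w'⟩) h
    · exact congrArg _ (hν h)
    · exact absurd ⟨v, h⟩ (hinl e' _ w'.2)
    · exact absurd ⟨v', h.symm⟩ (hinl e _ w.2)
    · obtain rfl := hinr e e' _ _ w.2 w'.2 h
      obtain rfl := Subtype.ext (hκ e h)
      rfl
  · refine Set.Subset.antisymm ?_ (Set.union_subset ?_ (Set.iUnion_subset fun e => ?_))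
    · rintro _ ⟨v | ⟨e, w⟩, rfl⟩
      · exact Or.inl ⟨v, rfl⟩
      · exact Or.inr (Set.mem_iUnion.2 ⟨e, w, rfl⟩)
    · rintro _ ⟨v, rfl⟩
      exact ⟨Sum.inl v, rfl⟩
    · rintro _ ⟨w, rfl⟩
      exact ⟨_, hμ e w⟩
  · refine (sum_subst_edges M K fun p => {(⟨(K p.1).rk p.2,
      μ ∘ (glue M _ p.1) ∘ (K p.1).att p.2, (K p.1).lab p.2⟩ : SeqEdge W)}).trans
      (Finset.sum_congr rfl fun e _ => Finset.sum_congr rfl fun e' _ => ?_)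
    have : μ ∘ (glue M (fun e => (K e).toSkel) e) ∘ (K e).att e' = κ e ∘ (K e).att e' :=
      funext fun i => hμ e _
    exact congrArg (fun a => {(⟨_, a, _⟩ : SeqEdge W)}) this

theorem handle_bag {n : ℕ} (T : Tp n) (κ : Fin n → W) : (handle T).bag κ = {⟨n, κ, T⟩} :=
  (sum_univ_inst _ _ _).trans (Fintype.sum_unique (ι := Unit) _)

theorem mem_range_handle_ext {n : ℕ} (T : Tp n) (w : Fin n) :
    w ∈ Set.range (handle T).ext := ⟨w, rfl⟩

/-- The multiset identity has the replaced edge added on the left, which avoids subtraction and lets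
it be cancelled later. -/
theorem exists_map_replace {r : ℕ} {G : Graph Tp r} {e₀ : G.E} {K : Graph Tp (G.rk e₀)}
    {ν : G.V → W} (hν : Function.Injective ν) {κ : K.V → W} (hκ : Function.Injective κ)
    (hext : ∀ i, κ (K.ext i) = ν (G.att e₀ i))
    (hinl : ∀ w, w ∉ Set.range K.ext → κ w ∉ Set.range ν) :
    ∃ μ : (G.replace e₀ K).V → W, Function.Injective μ ∧
      Set.range μ = Set.range ν ∪ Set.range κ ∧
      {⟨G.rk e₀, ν ∘ G.att e₀, G.lab e₀⟩} + (G.replace e₀ K).bag μ = K.bag κ + G.bag ν := by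
  classical
  have key : ∀ e, ∃ κ' : (Function.update (fun e => handle (G.lab e)) e₀ K e).V → W,
      Function.Injective κ' ∧
      (∀ i, κ' ((Function.update (fun e => handle (G.lab e)) e₀ K e).ext i) = ν (G.att e i)) ∧
      (∀ w, w ∉ Set.range (Function.update (fun e => handle (G.lab e)) e₀ K e).ext →
        e = e₀ ∧ κ' w ∉ Set.range ν) ∧
      (e = e₀ → Set.range κ' = Set.range κ) ∧ (e ≠ e₀ → Set.range κ' ⊆ Set.range ν) ∧
      (Function.update (fun e => handle (G.lab e)) e₀ K e).bag κ' =
        if e = e₀ then K.bag κ else {⟨G.rk e, ν ∘ G.att e, G.lab e⟩} := by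
    intro e
    by_cases he : e = e₀
    · subst he
      rw [Function.update_self]
      exact ⟨κ, hκ, hext, fun w hw => ⟨rfl, hinl w hw⟩, fun _ => rfl, fun h => absurd rfl h,
        (if_pos rfl).symm⟩
    · rw [Function.update_of_ne he, if_neg he]
      refine ⟨ν ∘ G.att e, hν.comp (G.att e).injective, fun _ => rfl,
        fun w hw => absurd (mem_range_handle_ext _ w) hw, fun h => absurd h he, fun _ => ?_,
        handle_bag _ _⟩
      exact Set.range_comp_subset_range _ _
  choose κ' h₁ h₂ h₃ h₄ h₅ h₆ using key
  obtain ⟨μ, hμ, hr, hb, -⟩ := exists_map_subst hν h₁ h₂ (fun e w hw => (h₃ e w hw).2)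
    (fun e e' w w' hw hw' _ => (h₃ e w hw).1.trans (h₃ e' w' hw').1.symm)
  refine ⟨μ, hμ, hr.trans (Set.Subset.antisymm ?_ ?_), ?_⟩
  · refine Set.union_subset Set.subset_union_left (Set.iUnion_subset fun e => ?_)
    by_cases he : e = e₀
    · rw [h₄ e he]
      exact Set.subset_union_right
    · exact (h₅ e he).trans Set.subset_union_left
  · refine Set.union_subset_union_right _ ?_
    rw [← h₄ e₀ rfl]
    exact Set.subset_iUnion (fun e => Set.range (κ' e)) e₀
  · refine (congrArg _ hb).trans ?_
    simp only [h₆]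
    have hG : G.bag ν = ∑ e, {⟨G.rk e, ν ∘ G.att e, G.lab e⟩} := rfl
    rw [hG, ← Finset.add_sum_erase _ _ (Finset.mem_univ e₀), ← Finset.add_sum_erase Finset.univ
      (fun e => ({⟨G.rk e, ν ∘ G.att e, G.lab e⟩} : Multiset (SeqEdge W))) (Finset.mem_univ e₀),
      if_pos rfl, add_left_comm]
    refine congrArg _ (congrArg _ (Finset.sum_congr rfl fun e he => ?_))
    rw [if_neg (Finset.ne_of_mem_erase he)]

/-- The image of an edge under a map of the nodes. -/
def TpEdge.map {V : Type} (j : V → W) (x : TpEdge V) : SeqEdge W := ⟨x.1, j ∘ x.2.1, x.2.2⟩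

theorem exists_map_fill {r k : ℕ} {D : DSkel r k} {F : Tp k} {lab : ∀ d : D.E, Tp (D.rk d)}
    {j : D.V → W} (hj : Function.Injective j) :
    ∃ μ : (D.fill (handle F) fun d => handle (lab d)).V → W, Function.Injective μ ∧
      Set.range μ = Set.range j ∧ (D.fill (handle F) fun d => handle (lab d)).bag μ =
        ({⟨k, j ∘ D.hole, F⟩} + ∑ d, {⟨D.rk d, j ∘ D.att d, lab d⟩} : Multiset (SeqEdge W)) ∧
      ∀ i, μ ((D.fill (handle F) fun d => handle (lab d)).ext i) = j (D.ext i) := by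
  have hs : ∀ {B : Type 1} [AddCommMonoid B] (f : Option D.E → B),
      ∑ e : D.full.E, f e = f none + ∑ d, f (some d) :=
    fun f => (sum_univ_inst _ _ f).trans (Fintype.sum_option f)
  let K : ∀ o : Option D.E, Graph Tp (D.full.rk o) := fun o => match o with
    | none => handle F
    | some d => handle (lab d)
  let κ : ∀ o : Option D.E, (K o).V → W := fun o => match o with
    | none => j ∘ D.hole
    | some d => j ∘ D.att d
  obtain ⟨μ, hμ, hr, hb, he⟩ := exists_map_subst (M := D.full) (K := K) (κ := κ) hj
    (fun o => match o with
      | none => hj.comp D.hole.injective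
      | some d => hj.comp (D.att d).injective)
    (fun o => match o with
      | none => fun i => rfl
      | some d => fun i => rfl)
    (fun o => match o with
      | none => fun w hw => absurd (mem_range_handle_ext _ w) hw
      | some d => fun w hw => absurd (mem_range_handle_ext _ w) hw)
    (fun o => match o with
      | none => fun e' w w' hw => absurd (mem_range_handle_ext _ w) hw
      | some d => fun e' w w' hw => absurd (mem_range_handle_ext _ w) hw)
  refine ⟨μ, hμ, hr.trans (Set.union_eq_left.2 (Set.iUnion_subset fun o => ?_)),
    hb.trans ((hs fun o => (K o).bag (κ o)).trans (congrArg₂ _ (handle_bag _ _)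
      (Finset.sum_congr rfl fun d _ => handle_bag _ _))), he⟩
  cases o with
  | none => exact Set.range_comp_subset_range D.hole j
  | some d => exact Set.range_comp_subset_range (D.att d) j

/-- The sequent with the given nodes and edges in the antecedent is derivable. -/
def BagDerivable (s : Set W) (m : Multiset (SeqEdge W)) (T : Tp 0) : Prop :=
  ∃ G, Rep G s m ∧ Derivable G T

theorem BagDerivable.derivable {s : Set W} {m : Multiset (SeqEdge W)} {T : Tp 0}
    (h : BagDerivable s m T) {G : Graph Tp 0} (hG : Rep G s m) : Derivable G T := by
  obtain ⟨H, hH, hd⟩ := h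
  exact .iso (hH.same hG) (.refl _) hd

/-- This is `÷→` with a handle substituted for each edge of `D`, so that an edge `N` is traded for
the division edge and the edges `l`. By `hs`, the non-external nodes of `D` are named by fresh
elements. -/
theorem BagDerivable.div {m n r k : ℕ} {N : Tp r} {ext : Fin r ↪ Fin m} {hole : Fin k ↪ Fin m}
    {l : Fin n → TpEdge (Fin m)} (hl : ∀ d, Derivable (handle (l d).2.2) (l d).2.2)
    {s : Set W} {X : Multiset (SeqEdge W)} {T : Tp 0} {j : Fin m → W} (hj : Function.Injective j)
    (hs : ∀ i, i ∉ Set.range ext → j i ∉ s) (h : BagDerivable s (⟨r, j ∘ ext, N⟩ ::ₘ X) T) :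
    BagDerivable (s ∪ Set.range j)
      ({⟨k, j ∘ hole, divFin N ext hole l⟩} + ∑ d, {(l d).map j} + X) T := by
  obtain ⟨G, ⟨ν, hν, rfl, hb⟩, hG⟩ := h
  have hmem : (⟨r, j ∘ ext, N⟩ : SeqEdge W) ∈ G.bag ν := hb ▸ Multiset.mem_cons_self _ _
  rw [Graph.bag_eq_map, Multiset.mem_map] at hmem
  obtain ⟨e₀, -, he⟩ := hmem
  -- This makes `r` definitionally the rank of `e₀`, as the replacement requires.
  obtain ⟨rfl, he⟩ := Sigma.mk.inj_iff.1 he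
  obtain ⟨ha, rfl⟩ := Prod.mk.inj (eq_of_heq he)
  let D : DSkel (G.rk e₀) k := { finSkel ext l with hole := hole }
  let lab : ∀ d : D.E, Tp (D.rk d) := fun d => (l d).2.2
  obtain ⟨κ, hκ, hκr, hκb, hκe⟩ := exists_map_fill (D := D) (F := Tp.div (G.lab e₀) D lab)
    (lab := lab) hj
  obtain ⟨μ, hμ, hμr, hμb⟩ := exists_map_replace (e₀ := e₀) hν hκ
    (fun i => (hκe i).trans (congrFun ha i).symm) (fun w hw => by
      obtain ⟨i, hi⟩ : κ w ∈ Set.range j := hκr ▸ ⟨w, rfl⟩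
      rw [← hi]
      refine hs i fun ⟨i', hi'⟩ => hw ⟨i', hκ ?_⟩
      rw [hκe, ← hi, ← hi']
      rfl)
  refine ⟨_, ⟨μ, hμ, hκr ▸ hμr, ?_⟩, Derivable.div_left G T e₀ D lab _ hG hl⟩
  rw [hb, hκb, ha, Multiset.singleton_add, Multiset.add_cons, Multiset.cons_inj_right] at hμb
  refine hμb.trans (congrArg (fun a => {_} + a + X) ?_)
  exact sum_univ_inst _ _ fun d => {(l d).map j}

/-- All nodes of the hypergraph under `×` are external, in their own order, so `×→` adds no node and
just splits one edge into the edges `l`. -/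
theorem derivable_of_times {G : Graph Tp 0} {n r : ℕ} {ext : Fin r ↪ Fin r}
    {l : Fin n → TpEdge (Fin r)} (hext : ∀ i, ext i = i) {s : Set W} {X : Multiset (SeqEdge W)}
    {T : Tp 0} {a : Fin r → W}
    (h : ∀ G, Rep G s (∑ d, {(l d).map a} + X) → Derivable G T)
    (hG : Rep G s (⟨r, a, timesFin ext l⟩ ::ₘ X)) : Derivable G T := by
  obtain ⟨ν, hν, rfl, hb⟩ := hG
  have hmem : (⟨r, a, timesFin ext l⟩ : SeqEdge W) ∈ G.bag ν := hb ▸ Multiset.mem_cons_self _ _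
  rw [Graph.bag_eq_map, Multiset.mem_map] at hmem
  obtain ⟨e₀, -, he⟩ := hmem
  obtain ⟨rfl, he⟩ := Sigma.mk.inj_iff.1 he
  obtain ⟨rfl, hlab⟩ := Prod.mk.inj (eq_of_heq he)
  let F : Graph Tp (G.rk e₀) := { finSkel ext l with lab := fun d => (l d).2.2 }
  obtain ⟨μ, hμ, hμr, hμb⟩ := exists_map_replace (e₀ := e₀) (K := F) (κ := ν ∘ G.att e₀) hν
    (hν.comp (G.att e₀).injective) (fun i => congrArg (ν ∘ G.att e₀) (hext i))
    (fun w hw => absurd ⟨w, hext w⟩ hw)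
  refine Derivable.times_left G T e₀ F hlab (h _ ⟨μ, hμ, ?_, ?_⟩)
  · exact hμr.trans (Set.union_eq_left.2 (Set.range_comp_subset_range _ _))
  · rw [hb, hlab, Multiset.singleton_add, Multiset.add_cons, Multiset.cons_inj_right] at hμb
    refine hμb.trans (congrArg (· + X) ?_)
    exact sum_univ_inst _ _ fun d => {(l d).map _}

end HL

/-! ### Deriving a chain step by step. -/

namespace HL

variable {W : Type}

/-- An edge of rank one attached to a given node. -/
abbrev seq₁ (v : W) (T : Tp 1) : SeqEdge W := ⟨1, fun _ => v, T⟩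

/-- An edge of rank two attached to given nodes. -/
abbrev seq₂ (u v : W) (T : Tp 2) : SeqEdge W := ⟨2, ![u, v], T⟩

theorem comp_pair {V : Type} (j : V → W) (u v : V) (h : u ≠ v) :
    j ∘ pair u v h = ![j u, j v] := by
  ext i
  fin_cases i <;> rfl

theorem BagDerivable.start (z : W) : BagDerivable {z} {seq₁ z zTp} startTp := by
  let M : Graph Tp 0 := { finSkel (m := 1) ⟨Fin.elim0, fun i => i.elim0⟩ ![edge₁ 0 zTp] with
    lab := fun d => (![edge₁ (0 : Fin 1) zTp] d).2.2 }
  have hs : ∀ {B : Type 1} [AddCommMonoid B] (f : M.E → B), ∑ e, f e = f (0 : Fin 1) :=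
    fun f => (sum_univ_inst _ _ f).trans (Fintype.sum_unique (ι := Fin 1) f)
  obtain ⟨μ, hμ, hr, hb, -⟩ := exists_map_subst (M := M.toSkel) (K := fun e => handle (M.lab e))
    (ν := fun _ => z) (κ := fun _ _ => z) (fun i j _ => Subsingleton.elim (α := Fin 1) i j)
    (fun e i j _ => by
      have : (M.rk e) = 1 := by
        change (![edge₁ (0 : Fin 1) zTp] e).1 = 1
        rw [Subsingleton.elim (α := Fin 1) e 0]
        rfl
      have hi : (i : Fin (M.rk e)).1 < 1 := this ▸ i.2
      have hj : (j : Fin (M.rk e)).1 < 1 := this ▸ j.2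
      exact Fin.ext (by omega))
    (fun _ _ => rfl) (fun e w hw => absurd (mem_range_handle_ext _ w) hw)
    (fun e e' w w' hw => absurd (mem_range_handle_ext _ w) hw)
  refine ⟨_, ⟨μ, hμ, hr.trans ?_, hb.trans ((hs _).trans (handle_bag _ _))⟩,
    Derivable.times_right M _ fun e => ?_⟩
  · ext x
    constructor
    · rintro (⟨_, rfl⟩ | hx)
      · rfl
      · obtain ⟨e, _, rfl⟩ := Set.mem_iUnion.1 hx
        rfl
    · rintro rfl
      exact Or.inl ⟨(0 : Fin 1), rfl⟩
  · obtain rfl : e = (0 : Fin 1) := Subsingleton.elim (α := Fin 1) e 0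
    exact Derivable.ax 1 3

theorem map_edge₂ {V : Type} (j : V → W) (u v : V) (h : u ≠ v) (T : Tp 2) :
    (edge₂ u v h T).map j = seq₂ (j u) (j v) T := by
  rw [TpEdge.map, comp_pair]

section Steps

variable {s : Set W} {X : Multiset (SeqEdge W)} {T : Tp 0} {u v w : W}

theorem BagDerivable.div₁ {m n : ℕ} {N : Tp 1} {i k : Fin m} {l : Fin n → TpEdge (Fin m)}
    (hl : ∀ d, Derivable (handle (l d).2.2) (l d).2.2) {j : Fin m → W}
    (hj : Function.Injective j) (hs : ∀ i', i' ≠ i → j i' ∉ s)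
    (h : BagDerivable s ({seq₁ (j i) N} + X) T) :
    BagDerivable (s ∪ Set.range j)
      ({seq₁ (j k) (divFin N (single i) (single k) l)} + ∑ d, {(l d).map j} + X) T :=
  BagDerivable.div (ext := single i) (hole := single k) hl hj
    (fun i' hi' => hs i' (by simpa using hi')) h

theorem BagDerivable.div₂ {m n : ℕ} {N : Tp 2} {i i' k : Fin m} {hii : i ≠ i'}
    {l : Fin n → TpEdge (Fin m)} (hl : ∀ d, Derivable (handle (l d).2.2) (l d).2.2)
    {j : Fin m → W} (hj : Function.Injective j) (hs : ∀ a, a ≠ i → a ≠ i' → j a ∉ s)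
    (h : BagDerivable s ({seq₂ (j i) (j i') N} + X) T) :
    BagDerivable (s ∪ Set.range j)
      ({seq₁ (j k) (divFin N (pair i i' hii) (single k) l)} + ∑ d, {(l d).map j} + X) T :=
  BagDerivable.div (ext := pair i i' hii) (hole := single k) hl hj
    (fun a ha => hs a (by rintro rfl; simp at ha) (by rintro rfl; simp at ha))
    (by rwa [comp_pair])

theorem union_range_const (hu : u ∈ s) : s ∪ Set.range (fun _ : Fin 1 => u) = s :=
  Set.union_eq_left.2 (by rintro _ ⟨_, rfl⟩; exact hu)

theorem union_range_pair (hu : u ∈ s) (hv : v ∈ s) : s ∪ Set.range ![u, v] = s :=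
  Set.union_eq_left.2 (by rintro _ ⟨i, rfl⟩; fin_cases i; exacts [hu, hv])

theorem injective_pair (h : u ≠ v) : Function.Injective ![u, v] := (pair u v h).injective

theorem BagDerivable.aTp_zero (h : BagDerivable s ({seq₂ u v yTp} + X) T) (hu : u ∈ s)
    (hv : v ∈ s) (huv : u ≠ v) : BagDerivable s
      ({seq₁ u uTp} + (({seq₁ u (aTp 0)} + {seq₁ v bTp} + {seq₁ v qTp}) + X)) T := by
  have := BagDerivable.div₂ (m := 2) (i := 0) (i' := 1) (hii := by decide) (k := 0)
    (l := ![edge₁ 0 uTp, edge₁ 1 bTp, edge₁ 1 qTp]) (by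
      intro d
      fin_cases d <;> exact Derivable.ax _ _) (injective_pair huv)
    (by intro i; fin_cases i <;> simp) h
  rw [union_range_pair hu hv, Fin.sum_univ_three] at this
  refine cast (congrArg (fun Y => BagDerivable s Y T) ?_) this
  change {seq₁ u (aTp 0)} + ({seq₁ u uTp} + {seq₁ v bTp} + {seq₁ v qTp}) + X = _
  abel

theorem BagDerivable.aTp_one (h : BagDerivable s ({seq₂ u v yTp} + X) T) (hu : u ∈ s)
    (hv : v ∈ s) (huv : u ≠ v) : BagDerivable s
      ({seq₂ u v yTp} + (({seq₁ u (aTp 1)} + {seq₁ v bTp} + {seq₁ v qTp}) + X)) T := by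
  have := BagDerivable.div₂ (m := 2) (i := 0) (i' := 1) (hii := by decide) (k := 0)
    (l := ![edge₂ 0 1 (by decide) yTp, edge₁ 1 bTp, edge₁ 1 qTp]) (by
      intro d
      fin_cases d <;> exact Derivable.ax _ _) (injective_pair huv)
    (by intro i; fin_cases i <;> simp) h
  rw [union_range_pair hu hv, Fin.sum_univ_three] at this
  refine cast (congrArg (fun Y => BagDerivable s Y T) ?_) this
  change {seq₁ u (aTp 1)} + ({TpEdge.map ![u, v] (edge₂ 0 1 (by decide) yTp)} + {seq₁ v bTp} +
    {seq₁ v qTp}) + X = _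
  rw [map_edge₂]
  change {seq₁ u (aTp 1)} + ({seq₂ u v yTp} + {seq₁ v bTp} + {seq₁ v qTp}) + X = _
  abel

theorem BagDerivable.aTp_two (h : BagDerivable s ({seq₂ u v yTp} + X) T) (hu : u ∈ s)
    (hv : v ∈ s) (huv : u ≠ v) (hw : w ∉ s) : BagDerivable (insert w s)
      ({seq₂ w u yTp} + (({seq₁ u (aTp 2)} + {seq₁ v bTp} + {seq₁ v qTp}) + X)) T := by
  have hwu : w ≠ u := fun h => hw (h ▸ hu)
  have hwv : w ≠ v := fun h => hw (h ▸ hv)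
  have := BagDerivable.div₂ (m := 3) (i := 0) (i' := 1) (hii := by decide) (k := 0) (j := ![u, v, w])
    (l := ![edge₂ 2 0 (by decide) yTp, edge₁ 1 bTp, edge₁ 1 qTp]) (by
      intro d
      fin_cases d <;> exact Derivable.ax _ _) (by
      intro i j
      fin_cases i <;> fin_cases j <;> simp [huv, huv.symm, hwu, hwu.symm, hwv, hwv.symm])
    (by intro i; fin_cases i <;> simp [hw]) h
  have hs : s ∪ Set.range ![u, v, w] = insert w s := by
    ext x
    simp
    grind
  rw [hs, Fin.sum_univ_three] at this
  refine cast (congrArg (fun Y => BagDerivable _ Y T) ?_) this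
  change {seq₁ u (aTp 2)} + ({TpEdge.map ![u, v, w] (edge₂ 2 0 (by decide) yTp)} + {seq₁ v bTp} +
    {seq₁ v qTp}) + X = _
  rw [map_edge₂]
  change {seq₁ u (aTp 2)} + ({seq₂ w u yTp} + {seq₁ v bTp} + {seq₁ v qTp}) + X = _
  abel

theorem BagDerivable.aTp_three (h : BagDerivable s ({seq₁ v zTp} + X) T) (hv : v ∈ s)
    (hw : w ∉ s) : BagDerivable (insert w s)
      ({seq₂ w v yTp} + ({seq₁ v (aTp 3)} + X)) T := by
  have hwv : w ≠ v := fun h => hw (h ▸ hv)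
  have := BagDerivable.div₁ (m := 2) (i := 0) (k := 0)
    (l := ![edge₂ 1 0 (by decide) yTp]) (by
      intro d
      fin_cases d; exact Derivable.ax _ _) (injective_pair hwv.symm)
    (by intro i; fin_cases i <;> simp [hw]) h
  have hs : s ∪ Set.range ![v, w] = insert w s := by
    ext x
    simp
    grind
  rw [hs, Fin.sum_univ_one] at this
  refine cast (congrArg (fun Y => BagDerivable _ Y T) ?_) this
  change {seq₁ v (aTp 3)} + {TpEdge.map ![v, w] (edge₂ 1 0 (by decide) yTp)} + X = _
  rw [map_edge₂]
  change {seq₁ v (aTp 3)} + {seq₂ w v yTp} + X = _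
  abel

theorem BagDerivable.aTp_four (h : BagDerivable s ({seq₁ v zTp} + X) T) (hv : v ∈ s) :
    BagDerivable s ({seq₁ v zTp} + ({seq₁ v (aTp 4)} + X)) T := by
  have := BagDerivable.div₁ (m := 1) (i := 0) (k := 0) (j := fun _ => v)
    (l := ![edge₁ 0 zTp]) (by
      intro d
      fin_cases d; exact Derivable.ax _ _) (Function.injective_of_subsingleton _)
    (by intro i; fin_cases i; simp) h
  rw [union_range_const hv, Fin.sum_univ_one] at this
  refine cast (congrArg (fun Y => BagDerivable _ Y T) ?_) this
  change {seq₁ v (aTp 4)} + {seq₁ v zTp} + X = _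
  abel

theorem BagDerivable.cTp_one (h : BagDerivable s ({seq₁ v uTp} + X) T) (hv : v ∈ s) :
    BagDerivable s ({seq₁ v (cTp 1)} + {seq₁ v qTp} + X) T := by
  have := BagDerivable.div₁ (m := 1) (i := 0) (k := 0) (j := fun _ => v)
    (l := ![edge₁ 0 qTp]) (by
      intro d
      fin_cases d; exact Derivable.ax _ _) (Function.injective_of_subsingleton _)
    (by intro i; fin_cases i; simp) h
  rwa [union_range_const hv, Fin.sum_univ_one] at this

theorem BagDerivable.cTp_two (h : BagDerivable s ({seq₁ v uTp} + X) T) (hv : v ∈ s) :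
    BagDerivable s ({seq₁ v uTp} + (({seq₁ v (cTp 2)} + {seq₁ v qTp}) + X)) T := by
  have := BagDerivable.div₁ (m := 1) (i := 0) (k := 0) (j := fun _ => v)
    (l := ![edge₁ 0 uTp, edge₁ 0 qTp]) (by
      intro d
      fin_cases d <;> exact Derivable.ax _ _) (Function.injective_of_subsingleton _)
    (by intro i; fin_cases i; simp) h
  rw [union_range_const hv, Fin.sum_univ_two] at this
  refine cast (congrArg (fun Y => BagDerivable _ Y T) ?_) this
  change {seq₁ v (cTp 2)} + ({seq₁ v uTp} + {seq₁ v qTp}) + X = _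
  abel

/-- For the steps that reproduce the edge `x` they expand: types 1 and 4 of `aTp` and type 2 of
`cTp`. -/
theorem BagDerivable.iterate {x Y : Multiset (SeqEdge W)}
    (step : ∀ X, BagDerivable s (x + X) T → BagDerivable s (x + (Y + X)) T)
    (h : BagDerivable s (x + X) T) (n : ℕ) : BagDerivable s (x + (n • Y + X)) T := by
  induction n with
  | zero => simpa using h
  | succ n ih =>
    have := step _ ih
    rwa [← add_assoc Y, ← succ_nsmul'] at this

end Steps

open Classical in
/-- The type of the other half of an edge going out of `v`, in a graph with the first node `f` and
the last node `z` of the chain; the flag tells whether the edge is the distinguished one. -/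
noncomputable def aIdx (f z v : W) (first : Prop) : Fin 5 :=
  if v = z then (if first then 3 else 4) else if first then (if v = f then 0 else 2) else 1

open Classical in
/-- The type of the first half of an edge going out of `v`. -/
noncomputable def cIdx (f v : W) (first : Prop) : Fin 3 :=
  if v = f then (if first then 1 else 2) else 0

/-- All edges attached to `v` in a regular graph of degree `n + 1`. -/
noncomputable def nodeBag (n : ℕ) (f z v : W) : Multiset (SeqEdge W) :=
  {seq₁ v (aTp (aIdx f z v True))} + n • {seq₁ v (aTp (aIdx f z v False))} +
    ({seq₁ v (cTp (cIdx f v True))} + n • {seq₁ v (cTp (cIdx f v False))}) +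
    (n + 1) • {seq₁ v qTp}

/-- The chain edge `y` on `u`, `v` awaits expansion: the `aTp` halves of `v` have already been
placed, its first halves and heads have not. Expanding it `n + 1` times places the latter together
with all `aTp` halves of `u`, and the last expansion either opens a fresh node `w` or, when `u = f`,
ends in `uTp`. The first halves and heads of `u` then come from the recursive call, or from
expanding `uTp`; this is why those of `v` stand apart from the full node bags in the conclusion. -/
theorem BagDerivable.chain (n : ℕ) {T : Tp 0} {f z : W} (L : List W) :
    ∀ {u v : W} {s : Set W} {X : Multiset (SeqEdge W)}, v ≠ f → (u :: L).Nodup → z ∉ u :: L →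
    (u :: L).getLast (List.cons_ne_nil _ _) = f → (∀ x ∈ L, x ∉ s) → u ∈ s → v ∈ s → u ≠ v →
    BagDerivable s ({seq₂ u v yTp} + X) T →
    BagDerivable (s ∪ {x | x ∈ L}) ((n + 1) • {seq₁ v bTp} + (n + 1) • {seq₁ v qTp} +
      ((u :: L).map (nodeBag n f z)).sum + X) T := by
  induction L with
  | nil =>
    intro u v s X hv _ hz hl _ hu hvs huv h
    obtain rfl : u = f := hl
    have hzu : u ≠ z := by simpa [eq_comm] using hz
    have := ((((h.iterate (fun X h => h.aTp_one hu hvs huv) n).aTp_zero hu hvs huv).iterate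
      (fun X h => h.cTp_two hu) n).cTp_one hu)
    convert this using 1
    · simp
    · simp only [nodeBag, aIdx, cIdx, if_neg hzu, if_true, if_false, List.map_cons, List.map_nil,
        List.sum_cons, List.sum_nil]
      module
  | cons w L ih =>
    intro u v s X hv hn hz hl hL hu hvs huv h
    have hzu : u ≠ z := by rintro rfl; simp at hz
    have hl' : (w :: L).getLast (List.cons_ne_nil _ _) = f := by simpa using hl
    have huf : u ≠ f := by
      rintro rfl
      exact (List.nodup_cons.1 hn).1 (hl' ▸ List.getLast_mem _)
    have hwu : w ≠ u := by rintro rfl; simp at hn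
    have hw : w ∉ s := hL w (by simp)
    have := ih (X := _) huf (List.nodup_cons.1 hn).2 (fun h => hz (List.mem_cons_of_mem _ h)) hl'
      (fun x hx => ?_) (Set.mem_insert w s) (Set.mem_insert_of_mem w hu) hwu
      ((h.iterate (fun X h => h.aTp_one hu hvs huv) n).aTp_two hu hvs huv hw)
    · convert this using 1
      · ext x
        simp
        grind
      · rw [List.map_cons, List.sum_cons]
        have hb : bTp = cTp 0 := rfl
        simp only [nodeBag, aIdx, cIdx, if_neg hzu, if_neg huf, if_true, if_false, hb]
        module
    · rintro (rfl | hx')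
      · exact (List.nodup_cons.1 (List.nodup_cons.1 hn).2).1 hx
      · exact hL x (by simp [hx]) hx'

end HL

/-! ### Every regular graph is generated. -/

namespace HL

/-- One application of `×→` per edge, by induction on `S`; the remaining edges are carried in `X`.
-/
theorem derivable_of_stars {W E : Type} {s : Set W} {T : Tp 0} (t h : E → W)
    (p : E → Fin 5 × Fin 3) (S : Finset E) : ∀ {X : Multiset (SeqEdge W)},
    (∀ G, Rep G s (∑ e ∈ S, ({seq₁ (t e) (aTp (p e).1)} + {seq₁ (t e) (cTp (p e).2)} +
      {seq₁ (h e) qTp}) + X) → Derivable G T) →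
    ∀ G, Rep G s (∑ e ∈ S, {seq₂ (t e) (h e) (starTp (p e))} + X) → Derivable G T := by
  classical
  induction S using Finset.induction_on with
  | empty => simp
  | insert e S he ih =>
    intro X hd G hG
    rw [Finset.sum_insert he, add_assoc, Multiset.singleton_add] at hG
    refine derivable_of_times (ext := pair 0 1 (by decide)) (by intro i; fin_cases i <;> rfl)
      (fun G hG => ?_) hG
    rw [add_left_comm] at hG
    refine ih (fun G hG => hd G ?_) G hG
    rw [Finset.sum_insert he]
    rw [Fin.sum_univ_three] at hG
    rwa [add_comm (_ + _ + _) (∑ e ∈ S, _), add_assoc]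

theorem exists_star_edge {W : Type} {n : ℕ} (a : Star n) (att : Fin n ↪ W) :
    ∃ t h, t ≠ h ∧ (∀ v, (∃ i : Fin n, (i : ℕ) = 0 ∧ att i = v) ↔ t = v) ∧
      (∀ v, (∃ i : Fin n, (i : ℕ) = 1 ∧ att i = v) ↔ h = v) ∧
      ∀ p, ∃ T : Tp n, starCorr a T ∧ (⟨n, att, T⟩ : SeqEdge W) = seq₂ t h (starTp p) := by
  cases a
  refine ⟨att 0, att 1, fun h => by simpa using att.injective h, fun v => ?_, fun v => ?_,
    fun p => ⟨starTp p, ⟨p, rfl⟩, ?_⟩⟩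
  · simp
  · simp [Fin.exists_fin_two]
  · have : (att : Fin 2 → W) = ![att 0, att 1] := by
      ext i
      fin_cases i <;> rfl
    exact congrArg (fun b => (⟨2, b, starTp p⟩ : SeqEdge W)) this

/-- Summation over the edges of a graph all of whose nodes have the outdegree `n + 1`. -/
theorem sum_edges_eq {V E B : Type*} [Fintype V] [Fintype E] [AddCommMonoid B] (t : E → V) (n : ℕ)
    (hn : ∀ v, Nat.card {e // t e = v} = n + 1) {ε : V → E} (hε : ∀ v, t (ε v) = v) {g : E → B}
    {a b : V → B} (ha : ∀ v, g (ε v) = a v) (hb : ∀ e, e ≠ ε (t e) → g e = b (t e)) :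
    ∑ e, g e = ∑ v, (a v + n • b v) := by
  classical
  rw [← Finset.sum_fiberwise Finset.univ t]
  refine Finset.sum_congr rfl fun v _ => ?_
  have hmem : ε v ∈ Finset.univ.filter (fun e => t e = v) := by simp [hε]
  have hc := hn v
  rw [Nat.card_eq_fintype_card, Fintype.card_subtype] at hc
  rw [← Finset.add_sum_erase _ _ hmem, ha, Finset.sum_congr rfl (g := fun _ => b v),
    Finset.sum_const, Finset.card_erase_of_mem hmem, hc, Nat.add_sub_cancel]
  intro e he
  obtain ⟨hne, he⟩ := Finset.mem_erase.1 he
  obtain rfl : t e = v := by simpa using he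
  exact hb e hne

/-- Any enumeration of the nodes serves, since the pieces at a node do not remember which edges they
come from. Its head is the last node `z` of the chain and its last entry is `f`; two nodes are
needed because `yTp` has rank 2. -/
theorem BagDerivable.nodes {W : Type} [Fintype W] [Nontrivial W] (n : ℕ) :
    ∃ f z : W, BagDerivable Set.univ (∑ v, nodeBag n f z v) startTp := by
  obtain ⟨z, u, L, hL⟩ : ∃ z u L, (Finset.univ : Finset W).toList = z :: u :: L := by
    have hlen : 1 < (Finset.univ : Finset W).toList.length := by
      rw [Finset.length_toList]
      exact Fintype.one_lt_card
    match (Finset.univ : Finset W).toList, hlen with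
    | z :: u :: L, _ => exact ⟨z, u, L, rfl⟩
  have hn : (z :: u :: L).Nodup := hL ▸ Finset.nodup_toList _
  set f := (u :: L).getLast (List.cons_ne_nil _ _) with hf
  have hz : z ∉ u :: L := (List.nodup_cons.1 hn).1
  have hzf : z ≠ f := fun h => hz (h ▸ List.getLast_mem _)
  have huz : u ≠ z := by rintro rfl; simp at hz
  have h := ((add_zero ({seq₁ z zTp} : Multiset (SeqEdge W))).symm ▸
    BagDerivable.start z : BagDerivable {z} ({seq₁ z zTp} + 0) startTp)
  have hz₁ : z ∈ ({z} : Set W) := rfl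
  have := BagDerivable.chain n L hzf (List.nodup_cons.1 hn).2 hz hf.symm (fun x hx => ?_)
    (Set.mem_insert _ _) (Set.mem_insert_of_mem _ hz₁) huz
    ((h.iterate (fun X h => h.aTp_four hz₁) n).aTp_three hz₁ huz)
  · refine ⟨f, z, ?_⟩
    have hsum : ∑ v, nodeBag n f z v = ((z :: u :: L).map (nodeBag n f z)).sum := by
      rw [← hL, Finset.sum_map_toList]
    convert this using 1
    · ext x
      have : x ∈ z :: u :: L := hL ▸ Finset.mem_toList.2 (Finset.mem_univ x)
      simp at this ⊢
      tauto
    · rw [hsum, List.map_cons, List.sum_cons]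
      have hb : bTp = cTp 0 := rfl
      conv_lhs => enter [1]; simp only [nodeBag, aIdx, cIdx, if_neg hzf, if_true, if_false]
      rw [hb]
      module
  · rintro (rfl | rfl)
    · exact (List.nodup_cons.1 (List.nodup_cons.1 hn).2).1 hx
    · exact hz (List.mem_cons_of_mem _ hx)

theorem subset_language : regularGraphs ⊆ regularGrammar.language := by
  classical
  rintro G ⟨⟨v₀⟩, k, hk, hG⟩
  obtain ⟨n, rfl⟩ : ∃ n, k = n + 1 := ⟨k - 1, by omega⟩
  choose t h hth ht hh hT using fun e => exists_star_edge (G.lab e) (G.att e)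
  have hout : ∀ v, Nat.card {e // t e = v} = n + 1 := by
    intro v
    rw [← (hG v).2, Graph.outdegree]
    simp only [ht]
  have hin : ∀ v, Nat.card {e // h e = v} = n + 1 := by
    intro v
    rw [← (hG v).1, Graph.indegree]
    simp only [hh]
  have hex : ∀ g : G.E → G.V, (∀ v, Nat.card {e // g e = v} = n + 1) → ∀ v, ∃ e, g e = v := by
    intro g hg v
    have : Nonempty {e // g e = v} := (Nat.card_pos_iff.1 (by rw [hg]; omega)).1
    exact ⟨this.some.1, this.some.2⟩
  choose ε hε using hex t hout
  choose ε' hε' using hex h hin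
  -- The degree is positive and loops are excluded, so an edge leaving `v₀` has two distinct
  -- endpoints.
  have : Nontrivial G.V := ⟨_, _, hth (ε v₀)⟩
  obtain ⟨f, z, hd⟩ := BagDerivable.nodes (W := G.V) n
  -- One outgoing edge `ε v` is singled out at each node; its tail halves get the types that are
  -- used exactly once per node.
  let p : G.E → Fin 5 × Fin 3 := fun e => (aIdx f z (t e) (e = ε (t e)), cIdx f (t e) (e = ε (t e)))
  choose F hF hF' using fun e => hT e (p e)
  refine ⟨F, hF, ?_⟩
  refine derivable_of_stars (W := G.V) (s := Set.univ) (X := 0) t h p Finset.univ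
    (fun H hH => hd.derivable ?_) _ ⟨id, Function.injective_id, Set.range_id, ?_⟩
  · convert hH using 1
    rw [add_zero, Finset.sum_add_distrib, Finset.sum_add_distrib,
      sum_edges_eq t n hout hε (g := fun e => {seq₁ (t e) (aTp (p e).1)})
        (a := fun v => {seq₁ v (aTp (aIdx f z v True))})
        (b := fun v => {seq₁ v (aTp (aIdx f z v False))}),
      sum_edges_eq t n hout hε (g := fun e => {seq₁ (t e) (cTp (p e).2)})
        (a := fun v => {seq₁ v (cTp (cIdx f v True))})
        (b := fun v => {seq₁ v (cTp (cIdx f v False))}),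
      -- Heads all have the same type; singling out `ε' v` only serves to fit the form of
      -- `sum_edges_eq`.
      sum_edges_eq h n hin hε' (g := fun e => {seq₁ (h e) qTp})
        (a := fun v => {seq₁ v qTp}) (b := fun v => {seq₁ v qTp}),
      ← Finset.sum_add_distrib, ← Finset.sum_add_distrib]
    · refine Finset.sum_congr rfl fun v _ => ?_
      rw [nodeBag, succ_nsmul']
    · intro v
      simp [hε']
    · intro e _
      rfl
    · intro v
      simp [p, hε]
    · intro e he
      simp [p, he]
    · intro v
      simp [p, hε]
    · intro e he
      simp [p, he]
  · rw [add_zero]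
    exact Finset.sum_congr rfl fun e _ => congrArg _ (hF' e)

end HL

theorem mainTheorem2 : ∃ Gr : HL.Grammar HL.Star 0, Gr.language = HL.regularGraphs :=
  ⟨HL.regularGrammar, HL.language_subset.antisymm HL.subset_language⟩
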